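/- All vector spaces are over $\mathbb C$, all $A_\infty$-categories are small and strictly unital, modules are strictly unital right $A_\infty$-modules, and signs are those of Seidel's book *Fukaya Categories and Picard-Lefschetz Theory*, so that the $A_\infty$-equations are $$\sum_{i,j}(-1)^{|a_1|+\cdots+|a_i|-i}\,\mu^{d-j+1}(a_d,\dots,a_{i+j+1},\mu^j(a_{i+j},\dots,a_{i+1}),a_i,\dots,a_1)=0 .$$ **Setting.** A rational representation of $\mathbb C^*$ is one which is the direct sum of its weight spaces of integer weights. A naive $\mathbb C^*$-action on an $A_\infty$-category $\mathcal A$ makes each $\hom^k_{\mathcal A}(X_0,X_1)$ a rational representation of $\mathbb C^*$, such that all $\mu^d_{\mathcal A}$ are equivariant and the strict identities $e_X$ are invariant. $\mathcal A$ is directed if it has finitely many, ordered, objects $X^1,\dots,X^m$, with $\hom_{\mathcal A}(X^i,X^j)$ finite-dimensional (in total) for $i<j$, equal to $\mathbb C\,e_{X^i}$ (with $e_{X^i}\neq 0$) for $i=j$, and zero for $i>j$. An equivariant $A_\infty$-module is an $A_\infty$-module $\mathcal M$ such that each graded piece of each $\mathcal M(X)$ is a rational representation of $\mathbb C^*$ and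 all structure maps $\mu^{d+1}_{\mathcal M}$ ($d\ge 0$) are equivariant. An equivariant twisted complex is a pair $(C,\delta)$. Here $C=\bigoplus_{i\in I}W_i\otimes X_i$ is a finite formal sum, with objects $X_i$ of $\mathcal A$ and finite-dimensional graded representations $W_i$ of $\mathbb C^*$, which one may take to be one-dimensional, of degree $n_i$ and weight $k_i$. The differential $\delta$ is a $\mathbb C^*$-invariant element of degree $1$ of $\bigoplus_{i,j}\mathrm{Hom}(W_i,W_j)\otimes\hom_{\mathcal A}(X_i,X_j)$ which is strictly decreasing with respect to a filtration of $I$ and satisfies $\sum_{k\ge1}\mu^k(\delta,\dots,\delta)=0$, where $\mu^k(\phi_k\otimes a_k,\dots,\phi_1\otimes a_1)=(-1)^{\sum_{p<q}|\phi_p|(|a_q|-1)}\,\phi_k\cdots\phi_1\otimes\mu^k_{\mathcal A}(a_k,\dots,a_1)$. Its Yoneda image is the equivariant $A_\infty$-module $\mathcal C$ with $\mathcal C(X)=\bigoplus_i W_i\otimes\hom_{\mathcal A}(X,X_i)$ and $$\mu^{d+1}_{\mathcal C}(c,a_d,\dots,a_1)=\sum_{k\ge0}\mu^{d+1+k}(\underbrace{\delta,\dots,\delta}_{k},c,a_d,\dots,a_1).$$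 **Proposition.** Let $\mathcal A$ be a directed $A_\infty$-category with a naive $\mathbb C^*$-action, and $\mathcal M$ an equivariant $A_\infty$-module over $\mathcal A$ such that the total cohomology $H^*(\mathcal M(X^k))$ is finite-dimensional for each $k$. Then there is an equivariant twisted complex whose Yoneda image $\mathcal C$ is quasi-isomorphic to $\mathcal M$: there is a closed $A_\infty$-module homomorphism $\mathcal C\to\mathcal M$ of degree $0$ which induces isomorphisms $H^*(\mathcal C(X^k))\cong H^*(\mathcal M(X^k))$ for all $k$. Moreover, the homomorphism can be chosen $\mathbb C^*$-invariant (all its components are equivariant). -/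

import Mathlib

universe u v w w'

/-- Composable sequences `(a_d, …, a_1)`, `a_i ∈ H X_{i-1} X_i`, from `X = X_0` to `X_d`. The entries
are written from left to right: `cons a_d (… (cons a_1 nil))`. The empty
sequence (`d = 0`) is included. -/
inductive Chain {Ob : Type u} (H : Ob → Ob → Type v) (X : Ob) : Ob → Type (max u v)
  | nil : Chain H X X
  | cons {Y Z : Ob} (a : H Y Z) (p : Chain H X Y) : Chain H X Z

namespace Chain

variable {Ob : Type u} {H : Ob → Ob → Type v}

def length {X Y : Ob} : Chain H X Y → ℕ
  | nil => 0
  | cons _ p => p.length + 1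

/-- Concatenation `(l, r)`. -/
def append {X Y Z : Ob} : Chain H Y Z → Chain H X Y → Chain H X Z
  | nil, r => r
  | cons a l, r => cons a (l.append r)

/-- Apply a map to all entries. -/
def map {H' : Ob → Ob → Type w} (f : ∀ X Y, H X Y → H' X Y) {X Y : Ob} :
    Chain H X Y → Chain H' X Y
  | nil => nil
  | cons a p => cons (f _ _ a) (p.map f)

/-- All `d + 1` ways `p = (l, r)` of cutting a sequence in two (possibly empty) pieces. -/
def splits {X Y : Ob} : Chain H X Y → List (Σ Z : Ob, Chain H Z Y × Chain H X Z)
  | nil => [⟨X, nil, nil⟩]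
  | cons a p => ⟨_, nil, cons a p⟩ :: p.splits.map fun s => ⟨s.1, cons a s.2.1, s.2.2⟩

section Linear

variable [∀ X Y, AddCommGroup (H X Y)] [∀ X Y, Module ℂ (H X Y)]

/-- Multilinearity over `ℂ` in the entries of the sequence. -/
def Multilinear {X Y : Ob} {V : Type w} [AddCommGroup V] [Module ℂ V]
    (f : Chain H X Y → V) : Prop :=
  (∀ (Z Z' : Ob) (l : Chain H Z' Y) (a b : H Z Z') (r : Chain H X Z),
    f (l.append (cons (a + b) r)) = f (l.append (cons a r)) + f (l.append (cons b r))) ∧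
  (∀ (Z Z' : Ob) (l : Chain H Z' Y) (c : ℂ) (a : H Z Z') (r : Chain H X Z),
    f (l.append (cons (c • a) r)) = c • f (l.append (cons a r)))

/-- Sequences of homogeneous entries, each one with a degree. -/
abbrev Homog (gr : ∀ X Y, ℤ → Submodule ℂ (H X Y)) (X Y : Ob) : Type (max u v) :=
  Chain (fun X Y => Σ n : ℤ, gr X Y n) X Y

variable {gr : ∀ X Y, ℤ → Submodule ℂ (H X Y)}

/-- The underlying sequence. -/
def Homog.val {X Y : Ob} (p : Homog gr X Y) : Chain H X Y :=
  Chain.map (fun _ _ a => (a.2 : H _ _)) p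

/-- The reduced degree `(|a_1| - 1) + ⋯ + (|a_d| - 1)`. -/
def Homog.rdeg {X Y : Ob} : Homog gr X Y → ℤ
  | nil => 0
  | cons a p => (a.1 - 1) + Homog.rdeg p

/-- The signed sum `∑ (-1)^(|a_1| + ⋯ + |a_i| - i) G(a_d, …, a_{i+1}; a_i, …, a_1)` over
`0 ≤ i ≤ d`. -/
def Homog.splitSum {V : Type w} [AddCommGroup V] {X Y : Ob}
    (G : ∀ Z : Ob, Chain H Z Y → Chain H X Z → V) (p : Homog gr X Y) : V :=
  ((Chain.splits p).map fun s =>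
    (Homog.rdeg s.2.2).negOnePow • G s.1 (Homog.val s.2.1) (Homog.val s.2.2)).sum

/-- The sum `∑_j K(a_d, …, a_{i+j+1}, μ(a_{i+j}, …, a_{i+1}), a_i, …, a_1)` for fixed `i`, where
`l = (a_d, …, a_{i+1})` and `r = (a_i, …, a_1)`. -/
def insertSum {V : Type w} [AddCommGroup V] {X Y Z : Ob}
    (μ : ∀ X Y : Ob, Chain H X Y → H X Y) (K : Chain H X Y → V)
    (l : Chain H Z Y) (r : Chain H X Z) : V :=
  (l.splits.map fun t => K (t.2.1.append (cons (μ _ _ t.2.2) r))).sum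

end Linear

end Chain

/-- Small strictly unital `A_∞`-categories over `ℂ`. A graded vector space is
given as its total space together with the family of homogeneous subspaces. The operations `μ^d` for
all `d` and all objects are collected in one map on composable sequences; the value on
empty sequences is zero, that is, there is no curvature. -/
structure AInfCat (Ob : Type u) where
  Hom : Ob → Ob → Type v
  [acg : ∀ X Y, AddCommGroup (Hom X Y)]
  [mod : ∀ X Y, Module ℂ (Hom X Y)]
  gr : ∀ X Y, ℤ → Submodule ℂ (Hom X Y)
  gr_internal : ∀ X Y, DirectSum.IsInternal (gr X Y)
  μ : ∀ X Y, Chain Hom X Y → Hom X Y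
  μ_nil : ∀ X, μ X X Chain.nil = 0
  μ_multilinear : ∀ X Y, Chain.Multilinear (μ X Y)
  /-- `μ^d` has degree `2 - d`. -/
  μ_degree : ∀ X Y (p : Chain.Homog gr X Y), μ X Y p.val ∈ gr X Y (p.rdeg + 2)
  /-- The `A_∞`-associativity equations. -/
  ainf : ∀ X Y (p : Chain.Homog gr X Y),
    p.splitSum (fun _ l r => Chain.insertSum μ (μ X Y) l r) = 0
  /-- The strict identities `e_X`. -/
  e : ∀ X, Hom X X
  e_degree : ∀ X, e X ∈ gr X X 0
  μ_e_right : ∀ X Y (a : Hom X Y), μ X Y (.cons a (.cons (e X) .nil)) = a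
  μ_e_left : ∀ X Y (n : ℤ) (a : Hom X Y), a ∈ gr X Y n →
    μ X Y (.cons (e Y) (.cons a .nil)) = n.negOnePow • a
  μ_e_zero : ∀ X Y Z (l : Chain Hom Z Y) (r : Chain Hom X Z), l.length + r.length ≠ 1 →
    μ X Y (l.append (.cons (e Z) r)) = 0

attribute [instance] AInfCat.acg AInfCat.mod

namespace AInfCat

variable {Ob : Type u}

/-- Directedness, for a finite ordered set of objects. -/
structure IsDirected [LinearOrder Ob] (A : AInfCat.{u, v} Ob) : Prop where
  finite : ∀ X Y, X < Y → Module.Finite ℂ (A.Hom X Y)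
  e_ne_zero : ∀ X, A.e X ≠ 0
  span_e : ∀ X, Submodule.span ℂ {A.e X} = ⊤
  zero : ∀ X Y, Y < X → Subsingleton (A.Hom X Y)

end AInfCat

section Representations

variable {V : Type w} [AddCommGroup V] [Module ℂ V]

/-- The subspace of a `ℂ^*`-representation on which `ℂ^*` acts with weight `i`. -/
def weightSpace (ρ : Representation ℂ ℂˣ V) (i : ℤ) : Submodule ℂ V where
  carrier := {x | ∀ z : ℂˣ, ρ z x = ((z ^ i : ℂˣ) : ℂ) • x}
  add_mem' := by
    intro a b ha hb z
    rw [map_add, ha z, hb z, smul_add]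
  zero_mem' := by
    intro z
    simp
  smul_mem' := by
    intro c x hx z
    rw [map_smul, hx z, smul_comm]

/-- Each homogeneous subspace is a subrepresentation, and is a rational representation of `ℂ^*`,
i.e. it is spanned by its weight vectors. -/
structure IsGradedRational (gr : ℤ → Submodule ℂ V) (ρ : Representation ℂ ℂˣ V) : Prop where
  invariant : ∀ (z : ℂˣ) (n : ℤ), ∀ x ∈ gr n, ρ z x ∈ gr n
  rational : ∀ n : ℤ, gr n ≤ ⨆ i : ℤ, gr n ⊓ weightSpace ρ i

end Representations

/-- Naive `ℂ^*`-actions on an `A_∞`-category. -/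
structure NaiveAction {Ob : Type u} (A : AInfCat.{u, v} Ob) where
  ρ : ∀ X Y, Representation ℂ ℂˣ (A.Hom X Y)
  graded_rational : ∀ X Y, IsGradedRational (A.gr X Y) (ρ X Y)
  μ_equivariant : ∀ X Y (z : ℂˣ) (p : Chain A.Hom X Y),
    A.μ X Y (p.map fun X Y a => ρ X Y z a) = ρ X Y z (A.μ X Y p)
  e_invariant : ∀ X (z : ℂˣ), ρ X X z (A.e X) = A.e X

/-- Strictly unital right `A_∞`-modules over `A`. The operations
`μ^{d+1}(b, a_d, …, a_1)`, for `d ≥ 0`, are collected in one map. -/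
structure AInfMod {Ob : Type u} (A : AInfCat.{u, v} Ob) where
  obj : Ob → Type w
  [acg : ∀ X, AddCommGroup (obj X)]
  [mod : ∀ X, Module ℂ (obj X)]
  gr : ∀ X, ℤ → Submodule ℂ (obj X)
  gr_internal : ∀ X, DirectSum.IsInternal (gr X)
  μ : ∀ X Y, Chain A.Hom X Y → obj Y →ₗ[ℂ] obj X
  μ_multilinear : ∀ X Y (b : obj Y), Chain.Multilinear fun p => μ X Y p b
  /-- `μ^{d+1}` has degree `1 - d`. -/
  μ_degree : ∀ X Y (n : ℤ), ∀ b ∈ gr Y n, ∀ p : Chain.Homog A.gr X Y,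
    μ X Y p.val b ∈ gr X (n + p.rdeg + 1)
  /-- The `A_∞`-module equations. -/
  ainf : ∀ X Y (b : obj Y) (p : Chain.Homog A.gr X Y),
    p.splitSum (fun Z l r =>
      μ X Z r (μ Z Y l b) + Chain.insertSum A.μ (fun q => μ X Y q b) l r) = 0
  μ_e : ∀ X (b : obj X), μ X X (.cons (A.e X) .nil) b = b
  μ_e_zero : ∀ X Y Z (b : obj Y) (l : Chain A.Hom Z Y) (r : Chain A.Hom X Z),
    l.length + r.length ≠ 0 → μ X Y (l.append (.cons (A.e Z) r)) b = 0

attribute [instance] AInfMod.acg AInfMod.mod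

/-- The structure of an equivariant module on an `A_∞`-module. -/
structure EquivariantStructure {Ob : Type u} {A : AInfCat.{u, v} Ob} (α : NaiveAction A)
    (M : AInfMod.{u, v, w} A) where
  ρ : ∀ X, Representation ℂ ℂˣ (M.obj X)
  graded_rational : ∀ X, IsGradedRational (M.gr X) (ρ X)
  μ_equivariant : ∀ X Y (z : ℂˣ) (b : M.obj Y) (p : Chain A.Hom X Y),
    M.μ X Y (p.map fun X Y a => α.ρ X Y z a) (ρ Y z b) = ρ X z (M.μ X Y p b)

namespace AInfMod

variable {Ob : Type u} {A : AInfCat.{u, v} Ob}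

/-- The differential `μ^1` on `M(X)`. -/
def d (M : AInfMod.{u, v, w} A) (X : Ob) : M.obj X →ₗ[ℂ] M.obj X := M.μ X X .nil

/-- The total cohomology `H^*(M(X)) = ker μ^1 / im μ^1`. The sign that turns `μ^1` into an ordinary
differential does not change it. -/
abbrev cohomology (M : AInfMod.{u, v, w} A) (X : Ob) : Type w :=
  LinearMap.ker (M.d X) ⧸ (LinearMap.range (M.d X)).comap (LinearMap.ker (M.d X)).subtype

/-- Closed degree zero morphisms `t : M → N` in the `A_∞`-category of modules (module
homomorphisms), with components `t^{d+1}(b, a_d, …, a_1)`, `d ≥ 0`, collected in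
one map. With the usual sign conventions for modules over `A_∞`-categories,
`(μ^1 t)(b, a_d, …, a_1)` is, up to the sign `(-1)^(|b| + |a_1| + ⋯ + |a_d| - d)`, the left
hand side of `closed`; in particular `t^1` anticommutes with `μ^1`, and `b ↦ (-1)^|b| t^1(b)` is a
chain map. -/
structure ClosedHom (M : AInfMod.{u, v, w} A) (N : AInfMod.{u, v, w'} A) where
  t : ∀ X Y, Chain A.Hom X Y → M.obj Y →ₗ[ℂ] N.obj X
  multilinear : ∀ X Y (b : M.obj Y), Chain.Multilinear fun p => t X Y p b
  degree : ∀ X Y (n : ℤ), ∀ b ∈ M.gr Y n, ∀ p : Chain.Homog A.gr X Y,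
    t X Y p.val b ∈ N.gr X (n + p.rdeg)
  closed : ∀ X Y (b : M.obj Y) (p : Chain.Homog A.gr X Y),
    p.splitSum (fun Z l r =>
      N.μ X Z r (t Z Y l b) + t X Z r (M.μ Z Y l b) +
        Chain.insertSum A.μ (fun q => t X Y q b) l r) = 0

namespace ClosedHom

variable {M : AInfMod.{u, v, w} A} {N : AInfMod.{u, v, w'} A}

theorem anticomm (f : ClosedHom M N) (X : Ob) (b : M.obj X) :
    N.d X (f.t X X .nil b) + f.t X X .nil (M.d X b) = 0 := by
  have h := f.closed X X b .nil
  have h0 : f.t X X (.cons (0 : A.Hom X X) .nil) b = 0 := by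
    have := (f.multilinear X X b).2 X X .nil 0 0 .nil
    simpa [Chain.append] using this
  simpa [Chain.Homog.splitSum, Chain.splits, Chain.insertSum, Chain.Homog.val, Chain.map,
    Chain.Homog.rdeg, Chain.append, A.μ_nil, h0, AInfMod.d] using h

/-- The map induced by `t^1` on cohomology (it differs from the one induced by the chain map
`b ↦ (-1)^|b| t^1(b)` by a sign in each degree). -/
def cohomologyMap (f : ClosedHom M N) (X : Ob) : M.cohomology X →ₗ[ℂ] N.cohomology X :=
  Submodule.mapQ _ _
    ((f.t X X .nil).restrict (p := LinearMap.ker (M.d X)) (q := LinearMap.ker (N.d X)) (by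
      intro b hb
      have h := f.anticomm X b
      rw [LinearMap.mem_ker] at hb ⊢
      simpa [hb] using h))
    (by
      rintro ⟨b, hb⟩ ⟨c, hc⟩
      refine ⟨-(f.t X X .nil c), ?_⟩
      have h := f.anticomm X c
      simp only [Submodule.subtype_apply] at hc
      rw [hc] at h
      simp only [map_neg, Submodule.subtype_apply, LinearMap.coe_restrict_apply]
      exact neg_eq_of_add_eq_zero_right h)

/-- Quasi-isomorphisms of `A_∞`-modules. -/
def IsQuasiIso (f : ClosedHom M N) : Prop :=
  ∀ X, Function.Bijective (f.cohomologyMap X)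

/-- Invariance under the `ℂ^*`-action on morphisms of equivariant modules. -/
def IsInvariant {α : NaiveAction A} (f : ClosedHom M N) (σ : EquivariantStructure α M)
    (τ : EquivariantStructure α N) : Prop :=
  ∀ X Y (z : ℂˣ) (b : M.obj Y) (p : Chain A.Hom X Y),
    f.t X Y (p.map fun X Y a => α.ρ X Y z a) (σ.ρ Y z b) = τ.ρ X z (f.t X Y p b)

end ClosedHom

end AInfMod

namespace Chain

section Insert

variable {Ob : Type u} {H : Ob → Ob → Type v} [∀ X Y, AddCommGroup (H X Y)]
  {ι : Type} [Fintype ι] [DecidableEq ι] {C : ι → Ob}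

/-- For a family `D i j ∈ H (C i) (C j)`, the sum of all expressions
`μ(D i_{k-1} i_k, …, D i_1 i_2, D i i_1, q)` with `0 ≤ k ≤ n`, where the term with indices
`i_0 = i, i_1, …, i_k = j` contributes to the component of index `j`. -/
def leftInsert (μ : ∀ X Y : Ob, Chain H X Y → H X Y) (D : ∀ i j, H (C i) (C j)) {X : Ob} :
    ℕ → ∀ i : ι, Chain H X (C i) → ∀ j : ι, H X (C j)
  | 0, i, q => Pi.single i (μ _ _ q)
  | n + 1, i, q => Pi.single i (μ _ _ q) + ∑ j, leftInsert μ D n j (cons (D i j) q)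

end Insert

end Chain

/-- Twisted complexes over `A`. The underlying formal direct sum is `⨁ i, W_i ⊗ X_i`, where
`W_i` is the one-dimensional graded vector space in degree `deg i`, that is, `⨁ i, X_i[-deg i]`.
(A summand with a general finite-dimensional graded multiplicity space is written as several
summands with the same value of `fil`.) As `Hom(W_i, W_j)` is one-dimensional of degree
`deg j - deg i`, an endomorphism of degree one of the formal sum is a matrix of elements of
degree `1 - (deg j - deg i)` in `hom(X_i, X_j)`. -/
structure TwistedComplex {Ob : Type u} (A : AInfCat.{u, v} Ob) where
  ι : Type
  [fintype : Fintype ι]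
  [decEq : DecidableEq ι]
  X : ι → Ob
  deg : ι → ℤ
  δ : ∀ i j, A.Hom (X i) (X j)
  δ_degree : ∀ i j, δ i j ∈ A.gr (X i) (X j) (1 + deg i - deg j)
  /-- `δ` is strictly decreasing with respect to a filtration of the index set. -/
  fil : ι → ℕ
  δ_fil : ∀ i j, δ i j ≠ 0 → fil j < fil i
  /-- The Maurer-Cartan equation `∑_{k ≥ 1} μ^k(δ, …, δ) = 0` in the additive enlargement. There,
  `μ^k(φ_k ⊗ a_k, …, φ_1 ⊗ a_1)` is `φ_k ⋯ φ_1 ⊗ μ^k(a_k, …, a_1)` with the Koszul sign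
  `(-1)^(∑_{p < q} |φ_p| (|a_q| - 1))`. For the summand of `μ^k(δ, …, δ)` with indices
  `i = i_0, …, i_k = j`, this is, up to a sign which depends only on `i` and `j`, the product of
  the signs inserted here. At most `fil i` successive entries of `δ`, starting at
  index `i`, can be nonzero. The empty sequence contributes `0`. -/
  maurer_cartan : ∀ i, Chain.leftInsert A.μ
    (fun i j => (deg i * (deg i - deg j)).negOnePow • δ i j) (fil i) i Chain.nil = 0

attribute [instance] TwistedComplex.fintype TwistedComplex.decEq

/-- Equivariant twisted complexes: now the one-dimensional space `W_i` carries the representation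
of `ℂ^*` with weight `wt i`, and `δ` is invariant. (Every finite-dimensional graded
rational representation is a direct sum of such `W_i`.) -/
structure EqTwistedComplex {Ob : Type u} {A : AInfCat.{u, v} Ob} (α : NaiveAction A) extends
    TwistedComplex A where
  wt : ι → ℤ
  δ_invariant : ∀ (z : ℂˣ) (i j : ι),
    ((z ^ (wt j - wt i) : ℂˣ) : ℂ) • α.ρ (X i) (X j) z (δ i j) = δ i j

namespace Chain

/-! Facts about sequences which are used to see that the Yoneda image of a twisted complex is a
module. -/

variable {Ob : Type u} {H : Ob → Ob → Type v}

theorem map_append {H' : Ob → Ob → Type w} (f : ∀ X Y, H X Y → H' X Y) {X Y Z : Ob}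
    (l : Chain H Y Z) (r : Chain H X Y) : (l.append r).map f = (l.map f).append (r.map f) := by
  induction l with
  | nil => rfl
  | cons a l ih => simp [append, map, ih]

section Linear

set_option linter.unusedSectionVars false

variable [∀ X Y, AddCommGroup (H X Y)] [∀ X Y, Module ℂ (H X Y)]
  {gr : ∀ X Y, ℤ → Submodule ℂ (H X Y)} {V : Type w} [AddCommGroup V]

theorem Multilinear.cons_right [Module ℂ V] {X Y Z : Ob} {f : Chain H X Z → V} (hf : Multilinear f)
    (a : H Y Z) : Multilinear fun p : Chain H X Y => f (cons a p) :=
  ⟨fun Z Z' l b c r => hf.1 Z Z' (cons a l) b c r,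
    fun Z Z' l b c r => hf.2 Z Z' (cons a l) b c r⟩

theorem Multilinear.sum [Module ℂ V] {κ : Type*} (s : Finset κ) {X Y : Ob} {f : κ → Chain H X Y → V}
    (hf : ∀ k ∈ s, Multilinear (f k)) : Multilinear fun p => ∑ k ∈ s, f k p := by
  refine ⟨fun Z Z' l a b r => ?_, fun Z Z' l c a r => ?_⟩
  · rw [← Finset.sum_add_distrib]
    exact Finset.sum_congr rfl fun k hk => (hf k hk).1 Z Z' l a b r
  · rw [Finset.smul_sum]
    exact Finset.sum_congr rfl fun k hk => (hf k hk).2 Z Z' l c a r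

theorem Multilinear.comp [Module ℂ V] {V' : Type*} [AddCommGroup V'] [Module ℂ V'] {X Y : Ob}
    {f : Chain H X Y → V} (hf : Multilinear f) (g : V →ₗ[ℂ] V') :
    Multilinear fun p => g (f p) := by
  refine ⟨fun Z Z' l a b r => ?_, fun Z Z' l c a r => ?_⟩
  · exact (congrArg g (hf.1 Z Z' l a b r)).trans (map_add g _ _)
  · exact (congrArg g (hf.2 Z Z' l c a r)).trans (map_smul g _ _)

theorem Multilinear.cons_add [Module ℂ V] {X Y Z : Ob} {f : Chain H X Z → V} (hf : Multilinear f)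
    (a b : H Y Z) (p : Chain H X Y) : f (cons (a + b) p) = f (cons a p) + f (cons b p) :=
  hf.1 _ _ nil a b p

theorem Multilinear.cons_smul [Module ℂ V] {X Y Z : Ob} {f : Chain H X Z → V} (hf : Multilinear f)
    (c : ℂ) (a : H Y Z) (p : Chain H X Y) : f (cons (c • a) p) = c • f (cons a p) :=
  hf.2 _ _ nil c a p

theorem Multilinear.cons_zero [Module ℂ V] {X Y Z : Ob} {f : Chain H X Z → V} (hf : Multilinear f)
    (p : Chain H X Y) : f (cons (0 : H Y Z) p) = 0 := by
  simpa using hf.cons_smul 0 (0 : H Y Z) p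

theorem Multilinear.cons_sum [Module ℂ V] {κ : Type*} (s : Finset κ) {X Y Z : Ob} {f : Chain H X Z → V}
    (hf : Multilinear f) (a : κ → H Y Z) (p : Chain H X Y) :
    f (cons (∑ k ∈ s, a k) p) = ∑ k ∈ s, f (cons (a k) p) := by
  classical
  induction s using Finset.induction_on with
  | empty => simpa using hf.cons_zero p
  | insert k s hk ih => rw [Finset.sum_insert hk, Finset.sum_insert hk, hf.cons_add, ih]

namespace Homog

theorem splitSum_congr {X Y : Ob} {G G' : ∀ Z : Ob, Chain H Z Y → Chain H X Z → V}
    (h : ∀ Z l r, G Z l r = G' Z l r) (p : Homog gr X Y) : p.splitSum G = p.splitSum G' := by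
  have : G = G' := by
    funext Z l r
    exact h Z l r
  rw [this]

theorem splitSum_zero {X Y : Ob} (p : Homog gr X Y) :
    p.splitSum (fun _ _ _ => (0 : V)) = 0 := by
  simp [splitSum]

theorem splitSum_add {X Y : Ob} (G G' : ∀ Z : Ob, Chain H Z Y → Chain H X Z → V)
    (p : Homog gr X Y) :
    p.splitSum (fun Z l r => G Z l r + G' Z l r) = p.splitSum G + p.splitSum G' := by
  simp [splitSum, smul_add, List.sum_map_add]

theorem splitSum_sum {κ : Type*} (s : Finset κ) {X Y : Ob}
    (G : κ → ∀ Z : Ob, Chain H Z Y → Chain H X Z → V) (p : Homog gr X Y) :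
    p.splitSum (fun Z l r => ∑ k ∈ s, G k Z l r) = ∑ k ∈ s, p.splitSum (G k) := by
  classical
  induction s using Finset.induction_on with
  | empty => simpa using splitSum_zero p
  | insert k s hk ih =>
    rw [Finset.sum_insert hk, ← ih, ← splitSum_add]
    exact splitSum_congr (fun Z l r => Finset.sum_insert hk) p

theorem splitSum_map [Module ℂ V] {V' : Type*} [AddCommGroup V'] [Module ℂ V'] (g : V →ₗ[ℂ] V') {X Y : Ob}
    (G : ∀ Z : Ob, Chain H Z Y → Chain H X Z → V) (p : Homog gr X Y) :
    p.splitSum (fun Z l r => g (G Z l r)) = g (p.splitSum G) := by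
  simp only [splitSum, map_list_sum, List.map_map]
  congr 2
  funext s
  simp [Units.smul_def]

theorem splitSum_cons {X Y Z : Ob} (G : ∀ W : Ob, Chain H W Z → Chain H X W → V)
    (a : Σ n : ℤ, gr Y Z n) (p : Homog gr X Y) :
    splitSum G (Chain.cons a p : Homog gr X Z) =
      (Homog.rdeg (Chain.cons a p : Homog gr X Z)).negOnePow •
          G Z nil (Homog.val (Chain.cons a p : Homog gr X Z)) +
        p.splitSum (fun W l r => G W (cons (a.2 : H Y Z) l) r) := by
  simp only [splitSum, splits, List.map_cons, List.sum_cons, List.map_map]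
  rfl

end Homog

theorem insertSum_cons {X Y Y' Z : Ob} (μ : ∀ X Y : Ob, Chain H X Y → H X Y)
    (K : Chain H X Y → V) (a : H Y' Y) (l : Chain H Z Y') (r : Chain H X Z) :
    insertSum μ K (cons a l) r =
      K (cons (μ _ _ (cons a l)) r) + insertSum μ (fun q => K (cons a q)) l r := by
  simp only [insertSum, splits, List.map_cons, List.sum_cons, List.map_map]
  rfl

theorem insertSum_nil {X Y : Ob} (μ : ∀ X Y : Ob, Chain H X Y → H X Y)
    (K : Chain H X Y → V) (r : Chain H X Y) :
    insertSum μ K nil r = K (cons (μ _ _ nil) r) := by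
  simp [insertSum, splits, append]

theorem insertSum_sum {κ : Type*} (s : Finset κ) {X Y Z : Ob}
    (μ : ∀ X Y : Ob, Chain H X Y → H X Y) (K : κ → Chain H X Y → V)
    (l : Chain H Z Y) (r : Chain H X Z) :
    insertSum μ (fun q => ∑ k ∈ s, K k q) l r = ∑ k ∈ s, insertSum μ (K k) l r := by
  classical
  induction s using Finset.induction_on with
  | empty => simp [insertSum]
  | insert k s hk ih =>
    rw [Finset.sum_insert hk, ← ih]
    simp [insertSum, Finset.sum_insert hk, List.sum_map_add]

theorem insertSum_add {X Y Z : Ob}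
    (μ : ∀ X Y : Ob, Chain H X Y → H X Y) (K K' : Chain H X Y → V)
    (l : Chain H Z Y) (r : Chain H X Z) :
    insertSum μ (fun q => K q + K' q) l r = insertSum μ K l r + insertSum μ K' l r := by
  simp [insertSum, List.sum_map_add]

theorem insertSum_map [Module ℂ V] {V' : Type*} [AddCommGroup V'] [Module ℂ V'] (g : V →ₗ[ℂ] V') {X Y Z : Ob}
    (μ : ∀ X Y : Ob, Chain H X Y → H X Y) (K : Chain H X Y → V)
    (l : Chain H Z Y) (r : Chain H X Z) :
    insertSum μ (fun q => g (K q)) l r = g (insertSum μ K l r) := by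
  simp only [insertSum, map_list_sum, List.map_map]
  rfl

end Linear

end Chain

namespace TwistedComplex

variable {Ob : Type u} {A : AInfCat.{u, v} Ob} (C : TwistedComplex A)

/-- The entries of `δ`, with the signs from the additive enlargement. -/
def δs (i j : C.ι) : A.Hom (C.X i) (C.X j) :=
  (C.deg i * (C.deg i - C.deg j)).negOnePow • C.δ i j

theorem δs_degree (i j : C.ι) : C.δs i j ∈ A.gr (C.X i) (C.X j) (1 + C.deg i - C.deg j) := by
  have h := C.δ_degree i j
  rcases Int.even_or_odd (C.deg i * (C.deg i - C.deg j)) with h' | h'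
  · simpa [δs, Int.negOnePow_even _ h'] using h
  · simpa [δs, Int.negOnePow_odd _ h'] using h

theorem δs_eq_zero (i j : C.ι) (h : C.fil i ≤ C.fil j) : C.δs i j = 0 := by
  have : C.δ i j = 0 := by
    by_contra h'
    exact absurd (C.δ_fil i j h') (not_lt.mpr h)
  simp [δs, this]

/-- The sum of all `μ(δ, …, δ, q)`, for `q` ending at `X_i`. -/
def ins {X : Ob} (i : C.ι) (q : Chain A.Hom X (C.X i)) : ∀ j, A.Hom X (C.X j) :=
  Chain.leftInsert A.μ C.δs (C.fil i) i q

theorem leftInsert_multilinear {X : Ob} (n : ℕ) (i : C.ι) :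
    Chain.Multilinear fun q : Chain A.Hom X (C.X i) => Chain.leftInsert A.μ C.δs n i q := by
  have h0 : ∀ i : C.ι, Chain.Multilinear
      fun q : Chain A.Hom X (C.X i) =>
        (Pi.single i (A.μ _ _ q) : ∀ j, A.Hom X (C.X j)) := fun i =>
    (A.μ_multilinear X (C.X i)).comp (LinearMap.single ℂ (fun j => A.Hom X (C.X j)) i)
  induction n generalizing i with
  | zero => exact h0 i
  | succ n ih =>
    have h1 := Chain.Multilinear.sum Finset.univ
      (fun j _ => (ih j).cons_right (C.δs i j))
    refine ⟨fun Z Z' l a b r => ?_, fun Z Z' l c a r => ?_⟩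
    · have e1 := (h0 i).1 Z Z' l a b r
      have e2 := h1.1 Z Z' l a b r
      simp only [Chain.leftInsert] at e1 e2 ⊢
      rw [e1, e2]
      abel
    · have e1 := (h0 i).2 Z Z' l c a r
      have e2 := h1.2 Z Z' l c a r
      simp only [Chain.leftInsert] at e1 e2 ⊢
      rw [e1, e2, smul_add]

theorem leftInsert_stable {X : Ob} (n : ℕ) (i : C.ι) (q : Chain A.Hom X (C.X i))
    (h : C.fil i ≤ n) : Chain.leftInsert A.μ C.δs n i q = C.ins i q := by
  have key : ∀ (m : ℕ) (i : C.ι) (q : Chain A.Hom X (C.X i)), C.fil i ≤ m →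
      Chain.leftInsert A.μ C.δs (m + 1) i q = Chain.leftInsert A.μ C.δs m i q := by
    intro m
    induction m with
    | zero =>
      intro i q hi
      simp only [Chain.leftInsert]
      refine (add_eq_left).2 (Finset.sum_eq_zero fun j _ => ?_)
      rw [C.δs_eq_zero i j (by omega)]
      exact (C.leftInsert_multilinear 0 j).cons_zero q
    | succ m ih =>
      intro i q hi
      rw [Chain.leftInsert, Chain.leftInsert]
      congr 1
      refine Finset.sum_congr rfl fun j _ => ?_
      by_cases hj : C.fil i ≤ C.fil j
      · rw [C.δs_eq_zero i j hj, (C.leftInsert_multilinear _ j).cons_zero q,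
          (C.leftInsert_multilinear _ j).cons_zero q]
      · exact ih j _ (by omega)
  induction n, h using Nat.le_induction with
  | base => rfl
  | succ n hn ih => rw [key n i q hn, ih]

theorem ins_multilinear {X : Ob} (i : C.ι) :
    Chain.Multilinear fun q : Chain A.Hom X (C.X i) => C.ins i q :=
  C.leftInsert_multilinear _ i

theorem ins_eq {X : Ob} (i : C.ι) (q : Chain A.Hom X (C.X i)) :
    C.ins i q = Pi.single i (A.μ _ _ q) + ∑ j, C.ins j (.cons (C.δs i j) q) := by
  rw [← C.leftInsert_stable (C.fil i + 1) i q (by omega), Chain.leftInsert]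
  congr 1
  refine Finset.sum_congr rfl fun j _ => ?_
  by_cases hj : C.fil i ≤ C.fil j
  · rw [C.δs_eq_zero i j hj, (C.leftInsert_multilinear _ j).cons_zero q,
      (C.ins_multilinear j).cons_zero q]
  · exact C.leftInsert_stable _ j _ (by omega)

theorem ins_nil (i : C.ι) : C.ins i Chain.nil = 0 := C.maurer_cartan i

/-- The sum of all `μ(δ, …, δ, q)` with at least one `δ`. -/
theorem ins_sub {X : Ob} (i : C.ι) (q : Chain A.Hom X (C.X i)) :
    ∑ j, C.ins j (.cons (C.δs i j) q) = C.ins i q - Pi.single i (A.μ _ _ q) := by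
  rw [C.ins_eq i q]
  abel

/-- The consequence of the associativity and Maurer-Cartan equations from which the module
equations follow. -/
theorem ins_ainf {X : Ob} (i : C.ι) (q : Chain.Homog A.gr X (C.X i)) :
    q.splitSum (fun _ l r => Chain.insertSum A.μ (fun p => C.ins i p) l r +
      ∑ j, C.ins j (.cons ((∑ k, C.ins k (.cons (C.δs i k) l)) j) r)) = 0 := by
  induction hn : C.fil i using Nat.strong_induction_on generalizing i q with
  | _ n ih =>
  have hnil : ∀ k, (∑ k', C.ins k' (.cons (C.δs k k') Chain.nil)) = 0 := by
    intro k
    rw [C.ins_sub, C.ins_nil, A.μ_nil]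
    simp
  -- the recursion for the first summand
  have h1 : ∀ (Z : Ob) (l : Chain A.Hom Z (C.X i)) (r : Chain A.Hom X Z),
      Chain.insertSum A.μ (fun p => C.ins i p) l r =
      LinearMap.single ℂ (fun j => A.Hom X (C.X j)) i (Chain.insertSum A.μ (A.μ _ _) l r) +
      ∑ k, Chain.insertSum A.μ (fun p => C.ins k (.cons (C.δs i k) p)) l r := by
    intro Z l r
    rw [← Chain.insertSum_sum, ← Chain.insertSum_map, ← Chain.insertSum_add]
    congr 1
    funext p
    rw [C.ins_eq i p]
    rfl
  have h2 : ∀ (Z : Ob) (l : Chain A.Hom Z (C.X i)) (r : Chain A.Hom X Z) (k : C.ι),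
      Chain.insertSum A.μ (fun p => C.ins k (.cons (C.δs i k) p)) l r =
      Chain.insertSum A.μ (fun p => C.ins k p) (.cons (C.δs i k) l) r -
        C.ins k (.cons (A.μ _ _ (.cons (C.δs i k) l)) r) := by
    intro Z l r k
    rw [Chain.insertSum_cons]
    abel
  have h3 : ∀ k, q.splitSum (fun Z l r =>
      Chain.insertSum A.μ (fun p => C.ins k p) (.cons (C.δs i k) l) r +
        ∑ j, C.ins j
          (.cons ((∑ k', C.ins k' (.cons (C.δs k k') (.cons (C.δs i k) l))) j) r)) = 0 := by
    intro k
    by_cases hk : C.fil i ≤ C.fil k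
    · rw [C.δs_eq_zero i k hk]
      rw [← Chain.Homog.splitSum_zero (V := ∀ j, A.Hom X (C.X j)) q]
      refine Chain.Homog.splitSum_congr (fun Z l r => ?_) q
      have e1 : Chain.insertSum A.μ (fun p => C.ins k p) (.cons 0 l) r = 0 := by
        rw [Chain.insertSum_cons, (A.μ_multilinear _ _).cons_zero,
          (C.ins_multilinear k).cons_zero]
        simp [Chain.insertSum, (C.ins_multilinear k).cons_zero]
      have e2 : (∑ k', C.ins k' (.cons (C.δs k k') (.cons 0 l))) = 0 :=
        Finset.sum_eq_zero fun k' _ =>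
          ((C.ins_multilinear k').cons_right (C.δs k k')).cons_zero l
      rw [e1, e2, zero_add]
      exact Finset.sum_eq_zero fun j _ => (C.ins_multilinear j).cons_zero r
    · have h := ih (C.fil k) (by omega) k
        (.cons ⟨1 + C.deg i - C.deg k, C.δs i k, C.δs_degree i k⟩ q) rfl
      rw [Chain.Homog.splitSum_cons, Chain.insertSum_nil, A.μ_nil,
        (C.ins_multilinear k).cons_zero, hnil k] at h
      rw [Finset.sum_eq_zero (fun j _ => by
        exact (C.ins_multilinear j).cons_zero _), zero_add, smul_zero, zero_add] at h
      exact h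
  -- combine
  have h4 := Finset.sum_eq_zero (fun k (_ : k ∈ (Finset.univ : Finset C.ι)) => h3 k)
  rw [← Chain.Homog.splitSum_sum (V := ∀ j, A.Hom X (C.X j))] at h4
  have h5 : q.splitSum (fun _ l r =>
      LinearMap.single ℂ (fun j => A.Hom X (C.X j)) i
        (Chain.insertSum A.μ (A.μ _ _) l r)) = 0 := by
    rw [Chain.Homog.splitSum_map, A.ainf, map_zero]
  have h6 := congrArg₂ (· + ·) h5 h4
  simp only [← Chain.Homog.splitSum_add, add_zero] at h6
  rw [← h6]
  refine Chain.Homog.splitSum_congr (fun Z l r => ?_) q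
  rw [h1, add_assoc]
  congr 1
  rw [Finset.sum_congr rfl fun k _ => h2 Z l r k, Finset.sum_sub_distrib,
    Finset.sum_add_distrib]
  rw [sub_add_eq_add_sub, add_sub_assoc]
  congr 1
  rw [sub_eq_iff_eq_add, Finset.sum_comm]
  rw [← Finset.sum_add_distrib]
  -- compare the components
  have h7 : ∀ k, C.ins k (.cons (A.μ _ _ (.cons (C.δs i k) l)) r) =
      ∑ j, C.ins j (.cons ((Pi.single k (A.μ _ _ (.cons (C.δs i k) l)) :
        ∀ j, A.Hom Z (C.X j)) j) r) := by
    intro k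
    rw [Finset.sum_eq_single k]
    · rw [Pi.single_eq_same]
    · intro j _ hj
      rw [Pi.single_eq_of_ne hj]
      exact (C.ins_multilinear j).cons_zero r
    · intro h
      exact absurd (Finset.mem_univ k) h
  rw [Finset.sum_add_distrib, Finset.sum_congr rfl fun k _ => h7 k,
    Finset.sum_comm (f := fun k j => C.ins j (.cons ((Pi.single k
      (A.μ _ _ (.cons (C.δs i k) l)) : ∀ j, A.Hom Z (C.X j)) j) r)),
    ← Finset.sum_add_distrib]
  refine Finset.sum_congr rfl fun j _ => ?_
  rw [← Finset.sum_add_distrib, Finset.sum_apply, (C.ins_multilinear j).cons_sum]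
  refine Finset.sum_congr rfl fun k _ => ?_
  rw [C.ins_sub k, Pi.sub_apply, ← (C.ins_multilinear j).cons_add, sub_add_cancel]

theorem ins_degree {X : Ob} (i : C.ι) (n : ℤ) (q : Chain.Homog A.gr X (C.X i))
    (hq : n = C.deg i + q.rdeg) (j : C.ι) :
    C.ins i q.val j ∈ A.gr X (C.X j) (n + 2 - C.deg j) := by
  induction hn : C.fil i using Nat.strong_induction_on generalizing i q with
  | _ m ih =>
  rw [C.ins_eq, Pi.add_apply, Finset.sum_apply]
  refine Submodule.add_mem _ ?_ (Submodule.sum_mem _ fun k _ => ?_)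
  · by_cases hj : j = i
    · subst hj
      rw [Pi.single_eq_same]
      have := A.μ_degree _ _ q
      convert this using 2
      omega
    · rw [Pi.single_eq_of_ne hj]
      exact Submodule.zero_mem _
  · by_cases hk : C.fil i ≤ C.fil k
    · rw [C.δs_eq_zero i k hk, (C.ins_multilinear k).cons_zero]
      exact Submodule.zero_mem _
    · refine ih (C.fil k) (by omega) k
        (.cons ⟨1 + C.deg i - C.deg k, C.δs i k, C.δs_degree i k⟩ q) ?_ rfl
      simp only [Chain.Homog.rdeg]
      omega

theorem ins_unit {X Z : Ob} (i : C.ι) (l : Chain A.Hom Z (C.X i)) (r : Chain A.Hom X Z)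
    (h : 2 ≤ l.length + r.length) :
    C.ins i (l.append (.cons (A.e Z) r)) = 0 := by
  induction hn : C.fil i using Nat.strong_induction_on generalizing i l with
  | _ m ih =>
  rw [C.ins_eq, A.μ_e_zero _ _ _ _ _ (by omega), Pi.single_zero, zero_add]
  refine Finset.sum_eq_zero fun k _ => ?_
  by_cases hk : C.fil i ≤ C.fil k
  · rw [C.δs_eq_zero i k hk, (C.ins_multilinear k).cons_zero]
  · refine ih (C.fil k) (by omega) k (.cons (C.δs i k) l) ?_ rfl
    simp only [Chain.length]
    omega

theorem ins_unit_right {X : Ob} (i : C.ι) (a : A.Hom X (C.X i)) :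
    C.ins i (.cons a (.cons (A.e X) .nil)) = Pi.single i a := by
  rw [C.ins_eq, A.μ_e_right]
  refine add_eq_left.2 (Finset.sum_eq_zero fun k _ => ?_)
  exact C.ins_unit k (.cons (C.δs i k) (.cons a .nil)) .nil (by simp [Chain.length])

/-- The homogeneous subspaces of `⨁ i, W_i ⊗ hom(X, X_i)`. -/
def yonedaGr (X : Ob) (n : ℤ) : Submodule ℂ (∀ i, A.Hom X (C.X i)) :=
  Submodule.pi Set.univ fun i => A.gr X (C.X i) (n - C.deg i)

theorem single_mem_yonedaGr {X : Ob} (i : C.ι) (n : ℤ) (a : A.Hom X (C.X i))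
    (ha : a ∈ A.gr X (C.X i) (n - C.deg i)) : Pi.single i a ∈ C.yonedaGr X n := by
  intro j _
  by_cases hj : j = i
  · subst hj
    rwa [Pi.single_eq_same]
  · rw [Pi.single_eq_of_ne hj]
    exact Submodule.zero_mem _

theorem yonedaGr_internal (X : Ob) : DirectSum.IsInternal (C.yonedaGr X) := by
  rw [DirectSum.isInternal_submodule_iff_iSupIndep_and_iSup_eq_top]
  have hA := fun i => (DirectSum.isInternal_submodule_iff_iSupIndep_and_iSup_eq_top _).1
    (A.gr_internal X (C.X i))
  constructor
  · intro n
    rw [Submodule.disjoint_def]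
    intro x hx hx'
    funext i
    have h1 : x i ∈ A.gr X (C.X i) (n - C.deg i) := hx i (Set.mem_univ i)
    have h2 : x i ∈ ⨆ (j : ℤ) (_ : j ≠ n - C.deg i), A.gr X (C.X i) j := by
      have h3 : (⨆ (j : ℤ) (_ : j ≠ n), C.yonedaGr X j) ≤
          (⨆ (j : ℤ) (_ : j ≠ n - C.deg i), A.gr X (C.X i) j).comap (LinearMap.proj i) := by
        refine iSup₂_le fun j hj y hy => ?_
        have h4 : y i ∈ A.gr X (C.X i) (j - C.deg i) := hy i (Set.mem_univ i)
        exact Submodule.mem_iSup_of_mem (j - C.deg i)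
          (Submodule.mem_iSup_of_mem (by omega) h4)
      exact h3 hx'
    exact Submodule.disjoint_def.1 ((hA i).1 (n - C.deg i)) _ h1 h2
  · rw [eq_top_iff]
    intro x _
    rw [← Finset.univ_sum_single x]
    refine Submodule.sum_mem _ fun i _ => ?_
    have h1 : (⨆ j, A.gr X (C.X i) j) ≤
        (⨆ n, C.yonedaGr X n).comap (LinearMap.single ℂ (fun j => A.Hom X (C.X j)) i) := by
      refine iSup_le fun j y hy => ?_
      refine Submodule.mem_iSup_of_mem (j + C.deg i) ?_
      refine C.single_mem_yonedaGr i _ y ?_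
      rwa [add_sub_cancel_right]
    exact h1 (by rw [(hA i).2]; exact Submodule.mem_top)

/-- The operations `(c, a_d, …, a_1) ↦ ∑_k μ(δ, …, δ, c, a_d, …, a_1)` (with `k` insertions
of `δ`) on the Yoneda image. -/
def yonedaOp (X Y : Ob) (p : Chain A.Hom X Y) :
    (∀ i, A.Hom Y (C.X i)) →ₗ[ℂ] (∀ i, A.Hom X (C.X i)) where
  toFun c := ∑ i, C.ins i (.cons (c i) p)
  map_add' c c' := by
    rw [← Finset.sum_add_distrib]
    exact Finset.sum_congr rfl fun i _ => (C.ins_multilinear i).cons_add _ _ p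
  map_smul' z c := by
    simp only [RingHom.id_apply, Finset.smul_sum]
    exact Finset.sum_congr rfl fun i _ => (C.ins_multilinear i).cons_smul _ _ p

theorem yoneda_ainf (X Y : Ob) (c : ∀ i, A.Hom Y (C.X i)) (p : Chain.Homog A.gr X Y) :
    p.splitSum (fun Z l r => C.yonedaOp X Z r (C.yonedaOp Z Y l c) +
      Chain.insertSum A.μ (fun q => C.yonedaOp X Y q c) l r) = 0 := by
  -- the case of one homogeneous component
  have h1 : ∀ (i : C.ι) (n : ℤ) (a : A.Hom Y (C.X i)), a ∈ A.gr Y (C.X i) n →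
      p.splitSum (fun Z l r => C.yonedaOp X Z r (C.ins i (.cons a l)) +
        Chain.insertSum A.μ (fun q => C.ins i (.cons a q)) l r) = 0 := by
    intro i n a ha
    have h := C.ins_ainf i (.cons ⟨n, a, ha⟩ p)
    rw [Chain.Homog.splitSum_cons, Chain.insertSum_nil, A.μ_nil,
      (C.ins_multilinear i).cons_zero, C.ins_sub, C.ins_nil, A.μ_nil] at h
    rw [Finset.sum_eq_zero (fun j _ => by
      rw [Pi.single_zero, sub_zero]
      exact (C.ins_multilinear j).cons_zero _), zero_add, smul_zero, zero_add] at h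
    rw [← h]
    refine Chain.Homog.splitSum_congr (fun Z l r => ?_) p
    rw [Chain.insertSum_cons, C.ins_sub, add_comm, add_right_comm, add_comm]
    congr 1
    simp only [yonedaOp, LinearMap.coe_mk, AddHom.coe_mk]
    have e : C.ins i (.cons (A.μ Z (C.X i) (.cons a l)) r) =
        ∑ j, C.ins j (.cons ((Pi.single i (A.μ _ _ (.cons a l)) :
          ∀ j, A.Hom Z (C.X j)) j) r) := by
      rw [Finset.sum_eq_single i]
      · rw [Pi.single_eq_same]
      · intro j _ hj
        rw [Pi.single_eq_of_ne hj]
        exact (C.ins_multilinear j).cons_zero r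
      · intro h
        exact absurd (Finset.mem_univ i) h
    rw [e, ← Finset.sum_add_distrib]
    refine Finset.sum_congr rfl fun j _ => ?_
    rw [← (C.ins_multilinear j).cons_add, Pi.sub_apply, add_sub_cancel]
  -- arbitrary elements
  have h2 : ∀ (i : C.ι) (a : A.Hom Y (C.X i)),
      p.splitSum (fun Z l r => C.yonedaOp X Z r (C.ins i (.cons a l)) +
        Chain.insertSum A.μ (fun q => C.ins i (.cons a q)) l r) = 0 := by
    intro i a
    have ha : a ∈ ⨆ n, A.gr Y (C.X i) n := by
      rw [((DirectSum.isInternal_submodule_iff_iSupIndep_and_iSup_eq_top _).1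
        (A.gr_internal Y (C.X i))).2]
      exact Submodule.mem_top
    induction ha using Submodule.iSup_induction' with
    | mem n a ha => exact h1 i n a ha
    | zero =>
      rw [← Chain.Homog.splitSum_zero (V := ∀ j, A.Hom X (C.X j)) p]
      refine Chain.Homog.splitSum_congr (fun Z l r => ?_) p
      simp [(C.ins_multilinear i).cons_zero, Chain.insertSum]
    | add a b _ _ iha ihb =>
      have h := congrArg₂ (· + ·) iha ihb
      simp only [← Chain.Homog.splitSum_add, add_zero] at h
      rw [← h]
      refine Chain.Homog.splitSum_congr (fun Z l r => ?_) p
      simp only [(C.ins_multilinear i).cons_add, map_add, Chain.insertSum_add]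
      abel
  have h3 := Finset.sum_eq_zero (fun i (_ : i ∈ (Finset.univ : Finset C.ι)) => h2 i (c i))
  rw [← Chain.Homog.splitSum_sum (V := ∀ j, A.Hom X (C.X j))] at h3
  rw [← h3]
  refine Chain.Homog.splitSum_congr (fun Z l r => ?_) p
  rw [Finset.sum_add_distrib, ← Chain.insertSum_sum, ← map_sum]
  rfl

/-- The Yoneda image of a twisted complex, as a module over `A`:
`X ↦ hom(X, C) = ⨁ i, W_i ⊗ hom(X, X_i)`. -/
def yoneda : AInfMod.{u, v, v} A where
  obj X := ∀ i, A.Hom X (C.X i)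
  gr := C.yonedaGr
  gr_internal := C.yonedaGr_internal
  μ := C.yonedaOp
  μ_multilinear X Y c := Chain.Multilinear.sum Finset.univ fun i _ =>
    (C.ins_multilinear i).cons_right (c i)
  μ_degree X Y n c hc p := by
    change (∑ i, C.ins i (.cons (c i) p.val)) ∈ C.yonedaGr X _
    refine Submodule.sum_mem _ fun i _ j _ => ?_
    have h := C.ins_degree i (n - 1 + p.rdeg)
      (.cons ⟨n - C.deg i, c i, hc i (Set.mem_univ i)⟩ p)
      (by simp only [Chain.Homog.rdeg]; omega) j
    have e : n + p.rdeg + 1 - C.deg j = n - 1 + p.rdeg + 2 - C.deg j := by ring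
    change _ ∈ A.gr X (C.X j) (n + p.rdeg + 1 - C.deg j)
    rw [e]
    exact h
  ainf := C.yoneda_ainf
  μ_e X c := by
    change (∑ i, C.ins i (.cons (c i) (.cons (A.e X) .nil))) = c
    simp only [C.ins_unit_right]
    exact Finset.univ_sum_single c
  μ_e_zero X Y Z c l r h := by
    change (∑ i, C.ins i (.cons (c i) (l.append (.cons (A.e Z) r)))) = 0
    refine Finset.sum_eq_zero fun i _ => ?_
    exact C.ins_unit i (.cons (c i) l) r (by simp only [Chain.length]; omega)

end TwistedComplex

namespace EqTwistedComplex

variable {Ob : Type u} {A : AInfCat.{u, v} Ob} {α : NaiveAction A} (C : EqTwistedComplex α)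

theorem rho_δs (z : ℂˣ) (i j : C.ι) :
    ((z ^ (C.wt j - C.wt i) : ℂˣ) : ℂ) • α.ρ (C.X i) (C.X j) z (C.δs i j) = C.δs i j := by
  rcases Int.even_or_odd (C.deg i * (C.deg i - C.deg j)) with h' | h'
  · simpa [TwistedComplex.δs, Int.negOnePow_even _ h'] using C.δ_invariant z i j
  · simpa [TwistedComplex.δs, Int.negOnePow_odd _ h'] using C.δ_invariant z i j

/-- The action of `ℂ^*` on `⨁ i, W_i ⊗ hom(X, X_i)`. -/
def yonedaRep (X : Ob) : Representation ℂ ℂˣ (∀ i, A.Hom X (C.X i)) where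
  toFun z := LinearMap.pi fun i =>
    ((z ^ C.wt i : ℂˣ) : ℂ) • (α.ρ X (C.X i) z) ∘ₗ LinearMap.proj i
  map_one' := by
    ext c i
    simp
  map_mul' z z' := by
    refine LinearMap.ext fun c => funext fun i => ?_
    simp [mul_zpow, mul_smul]

theorem yonedaRep_apply (X : Ob) (z : ℂˣ) (c : ∀ i, A.Hom X (C.X i)) (i : C.ι) :
    C.yonedaRep X z c i = ((z ^ C.wt i : ℂˣ) : ℂ) • α.ρ X (C.X i) z (c i) := rfl

theorem ins_equivariant {X : Ob} (z : ℂˣ) (i : C.ι) (q : Chain A.Hom X (C.X i)) :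
    ((z ^ C.wt i : ℂˣ) : ℂ) • C.ins i (q.map fun X Y a => α.ρ X Y z a) =
      C.yonedaRep X z (C.ins i q) := by
  induction hn : C.fil i using Nat.strong_induction_on generalizing i q with
  | _ m ih =>
  rw [C.ins_eq, C.ins_eq i q, map_add, map_sum, smul_add, Finset.smul_sum, α.μ_equivariant]
  congr 1
  · funext j
    rw [yonedaRep_apply, Pi.smul_apply]
    by_cases hj : j = i
    · subst hj
      rw [Pi.single_eq_same, Pi.single_eq_same]
    · rw [Pi.single_eq_of_ne hj, Pi.single_eq_of_ne hj, map_zero, smul_zero, smul_zero]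
  · refine Finset.sum_congr rfl fun k _ => ?_
    by_cases hk : C.fil i ≤ C.fil k
    · rw [C.δs_eq_zero i k hk, (C.ins_multilinear k).cons_zero,
        (C.ins_multilinear k).cons_zero, map_zero, smul_zero]
    · rw [← ih (C.fil k) (by omega) k _ rfl, Chain.map]
      conv_lhs => rw [← C.rho_δs z i k]
      rw [(C.ins_multilinear k).cons_smul, smul_smul, ← Units.val_mul, ← zpow_add]
      congr 3
      ring_nf

/-- The Yoneda image of an equivariant twisted complex is an equivariant module. -/
def yonedaEquivariant : EquivariantStructure α C.yoneda where
  ρ := C.yonedaRep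
  graded_rational X := by
    constructor
    · intro z n c hc i _
      exact Submodule.smul_mem _ _
        ((α.graded_rational X (C.X i)).invariant z _ _ (hc i (Set.mem_univ i)))
    · intro n c hc
      change c ∈ ⨆ k : ℤ, C.yonedaGr X n ⊓ weightSpace (C.yonedaRep X) k
      have hc' : c = ∑ i, Pi.single i (c i) := (Finset.univ_sum_single c).symm
      rw [hc']
      refine Submodule.sum_mem _ fun i _ => ?_
      have h1 : (⨆ k : ℤ, A.gr X (C.X i) (n - C.deg i) ⊓ weightSpace (α.ρ X (C.X i)) k) ≤
          (⨆ k : ℤ, C.yonedaGr X n ⊓ weightSpace (C.yonedaRep X) k).comap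
            (LinearMap.single ℂ (fun j => A.Hom X (C.X j)) i) := by
        refine iSup_le fun k y hy => ?_
        refine Submodule.mem_iSup_of_mem (k + C.wt i) ⟨C.single_mem_yonedaGr i n y hy.1, ?_⟩
        intro z
        have hz := hy.2 z
        funext j
        rw [yonedaRep_apply, Pi.smul_apply, LinearMap.single_apply]
        by_cases hj : j = i
        · subst hj
          rw [Pi.single_eq_same, hz, smul_smul, ← Units.val_mul, ← zpow_add, add_comm]
        · rw [Pi.single_eq_of_ne hj, map_zero, smul_zero, smul_zero]
      exact h1 ((α.graded_rational X (C.X i)).rational _ (hc i (Set.mem_univ i)))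
  μ_equivariant X Y z c p := by
    change (∑ i, C.ins i (.cons (C.yonedaRep Y z c i) (p.map fun X Y a => α.ρ X Y z a))) =
      C.yonedaRep X z (∑ i, C.ins i (.cons (c i) p))
    rw [map_sum]
    refine Finset.sum_congr rfl fun i _ => ?_
    rw [← C.ins_equivariant z i]
    exact (C.ins_multilinear i).cons_smul _ _ _

end EqTwistedComplex

/-! The twisted complex is built one generator at a time, in the way one kills classes when building
a cell complex or a minimal resolution. Given an invariant closed homomorphism `f` from the Yoneda
image of a twisted complex `C` to `M`, consider at each object `X` the cone of `f`, that is `C(X) ×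
M(X)` with `coneD`. Acyclicity of all these cones makes `f` a quasi-isomorphism
(`isQuasiIso_of_cone_acyclic`). The start is `C = 0`, where the cone has the cohomology of `M`.

Suppose the cone at `X₀` is not acyclic. Since the differential respects degrees and weights, there
is a nonbounding cocycle `v = (c, m)` with a single degree and a single weight
(`exists_homogeneous_cocycle`). Its first part `c` is a cocycle in `C(X₀)`, and serves as the
differential from a new summand `X₀`, of matching degree and weight, to `C` (`adjoin`). Its second
part `m` is what makes `f` extend: on the new summand, the extension sends `(a, a_d, …, a_1)` to
`f(c, a, a_d, …, a_1) + μ(m, a, a_d, …, a_1)` (`coneEval`, `adjoinClosedHom`).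

The old cone at `X` is a subcomplex of the new one, with quotient `hom(X, X₀)`. At `X₀` this
quotient is the line spanned by the identity, which by strict unitality bounds `v`
(`coneD_coneGenerator`); hence the dimension of the cohomology drops (`endHomology_finrank_lt`), and
finitely many such steps make the cone acyclic at `X₀`. At `X > X₀` the quotient is zero by
directedness, so acyclicity already achieved is kept. At smaller objects the cohomology may change,
but it stays finite-dimensional because the morphism spaces are (`endHomology_finite_of_extension`).
Treating the objects in decreasing order therefore ends with a cone that is acyclic everywhere. -/

/-! ### Linear algebra: graded kernels, weight spaces, homology of extensions -/

section LinearAlgebra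

/-- A linear map which sends each `G i` to `G' i`, where the `G' i` are independent, has its kernel
spanned by elements of the `G i`, as far as it lies in their sum. -/
theorem ker_inf_iSup_le {V : Type*} {V' : Type*} [AddCommGroup V] [Module ℂ V] [AddCommGroup V']
    [Module ℂ V'] {κ : Type*} (D : V →ₗ[ℂ] V') (G : κ → Submodule ℂ V) (G' : κ → Submodule ℂ V')
    (hG' : iSupIndep G') (hD : ∀ i, ∀ x ∈ G i, D x ∈ G' i) :
    LinearMap.ker D ⊓ ⨆ i, G i ≤ ⨆ i, G i ⊓ LinearMap.ker D := by
  classical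
  rintro y ⟨hy, hy'⟩
  obtain ⟨g, hg, rfl⟩ := (Submodule.mem_iSup_iff_exists_finsupp G y).1 hy'
  have h0 : ∑ i ∈ g.support, D (g i) = 0 := by
    rw [← map_sum]
    exact hy
  -- The images of the components lie in independent subspaces and add up to zero, so each of them
  -- vanishes.
  have h1 := (iSupIndep_iff_finsetSum_eq_zero_imp_eq_zero G').1 hG' g.support (fun i => D (g i))
    (fun i _ => hD i _ (hg i)) h0
  exact Submodule.sum_mem _ fun i hi =>
    Submodule.mem_iSup_of_mem i ⟨hg i, h1 i hi⟩

theorem iSupIndep_prod {V : Type*} {V' : Type*} [AddCommGroup V] [Module ℂ V] [AddCommGroup V']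
    [Module ℂ V'] {κ : Type*} {G : κ → Submodule ℂ V} {G' : κ → Submodule ℂ V'}
    (hG : iSupIndep G) (hG' : iSupIndep G') : iSupIndep fun i => (G i).prod (G' i) := by
  rw [iSupIndep_iff_finsetSum_eq_zero_imp_eq_zero] at *
  intro s x hx h i hi
  refine Prod.ext ?_ ?_
  · refine hG s (fun i => (x i).1) (fun i hi => (hx i hi).1) ?_ i hi
    rw [← Prod.fst_sum, h, Prod.fst_zero]
  · refine hG' s (fun i => (x i).2) (fun i hi => (hx i hi).2) ?_ i hi
    rw [← Prod.snd_sum, h, Prod.snd_zero]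

/-- The single group element `2` already separates the weights: weight `i` vectors are eigenvectors
of its action with eigenvalue `2 ^ i`, and these eigenvalues are distinct. -/
theorem iSupIndep_weightSpace {V : Type*} [AddCommGroup V] [Module ℂ V]
    (ρ : Representation ℂ ℂˣ V) : iSupIndep (weightSpace ρ) := by
  have h2 : (2 : ℂ) ≠ 0 := two_ne_zero
  have hinj : Function.Injective fun i : ℤ => (2 : ℂ) ^ i := by
    intro i j hij
    have h : (2 : ℝ) ^ i = (2 : ℝ) ^ j := by simpa using congrArg norm hij
    exact zpow_right_injective₀ (by norm_num) (by norm_num) h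
  refine ((Module.End.eigenspaces_iSupIndep (ρ (Units.mk0 2 h2))).comp hinj).mono fun i x hx => ?_
  rw [Function.comp_apply, Module.End.mem_eigenspace_iff, hx, Units.val_zpow_eq_zpow_val,
    Units.val_mk0]

/-- The homology `ker D / im D` of an endomorphism (usually with `D ^ 2 = 0`). -/
abbrev endHomology {V : Type*} [AddCommGroup V] [Module ℂ V] (D : V →ₗ[ℂ] V) : Type _ :=
  LinearMap.ker D ⧸ (LinearMap.range D).comap (LinearMap.ker D).subtype

variable {V : Type*} {V' : Type*} {W : Type*} [AddCommGroup V] [Module ℂ V] [AddCommGroup V']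
  [Module ℂ V'] [AddCommGroup W] [Module ℂ W]
  {D : V →ₗ[ℂ] V} {D' : V' →ₗ[ℂ] V'} {i : V →ₗ[ℂ] V'}

/-- The map on homology induced by a map which commutes with the endomorphisms. -/
def endHomologyMap (hi : ∀ x, D' (i x) = i (D x)) : endHomology D →ₗ[ℂ] endHomology D' :=
  Submodule.mapQ _ _
    (i.restrict (p := LinearMap.ker D) (q := LinearMap.ker D') fun x hx => by
      rw [LinearMap.mem_ker] at *
      rw [hi, hx, map_zero])
    (by
      rintro ⟨b, hb⟩ ⟨c, hc⟩
      refine ⟨i c, ?_⟩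
      simp only [Submodule.subtype_apply] at hc
      rw [hi, hc]
      rfl)

theorem endHomologyMap_mk (hi : ∀ x, D' (i x) = i (D x)) (x : V) (hx : D x = 0)
    (hx' : D' (i x) = 0) :
    endHomologyMap hi (Submodule.Quotient.mk ⟨x, hx⟩) = Submodule.Quotient.mk ⟨i x, hx'⟩ := rfl

/-- Extending a complex by a finite-dimensional one keeps the homology finite-dimensional. -/
theorem endHomology_finite_of_extension (hi : ∀ x, D' (i x) = i (D x))
    (hinj : Function.Injective i) (hD' : ∀ y, D' (D' y) = 0) (π : V' →ₗ[ℂ] W) (hπ : ∀ y, π y = 0 → ∃ x, i x = y)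
    [Module.Finite ℂ W] [Module.Finite ℂ (endHomology D)] :
    Module.Finite ℂ (endHomology D') := by
  -- No differential on `W` is needed: dividing by the image of the boundaries makes `π` well
  -- defined on homology.
  let φ : endHomology D' →ₗ[ℂ] W ⧸ (LinearMap.range D').map π :=
    Submodule.mapQ _ _ (π ∘ₗ (LinearMap.ker D').subtype) fun y hy =>
      Submodule.mem_map_of_mem (f := π) hy
  refine ⟨Submodule.fg_of_fg_map_of_fg_inf_ker φ (IsNoetherian.noetherian _) ?_⟩
  have hle : LinearMap.ker φ ≤ LinearMap.range (endHomologyMap hi) := by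
    intro y hy
    obtain ⟨⟨y, hy0⟩, rfl⟩ := Submodule.Quotient.mk_surjective _ y
    have h1 : π y ∈ (LinearMap.range D').map π :=
      (Submodule.Quotient.mk_eq_zero _).1 (LinearMap.mem_ker.1 hy)
    obtain ⟨_, ⟨y1, rfl⟩, hy1⟩ := h1
    -- Correcting the cocycle by a boundary moves it into the subcomplex.
    obtain ⟨x, hx⟩ := hπ (y - D' y1) (by rw [map_sub, hy1, sub_self])
    have hx0 : D x = 0 := hinj (by
      rw [← hi, hx, map_sub, hD', LinearMap.mem_ker.1 hy0, sub_zero, map_zero])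
    refine ⟨Submodule.Quotient.mk ⟨x, hx0⟩, ?_⟩
    rw [endHomologyMap_mk hi x hx0 (by rw [hi, hx0, map_zero]), Submodule.Quotient.eq]
    refine ⟨-y1, ?_⟩
    change D' (-y1) = i x - y
    rw [map_neg, hx]
    abel
  have : Module.Finite ℂ (LinearMap.ker φ) := Submodule.finiteDimensional_of_le hle
  rw [top_inf_eq]
  exact Submodule.fg_iff_finiteDimensional _ |>.2 this

/-- Killing a nonzero homology class decreases the dimension. -/
theorem endHomology_finrank_lt (hi : ∀ x, D' (i x) = i (D x)) (hinj : Function.Injective i)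
    (v : V) (hv : D v = 0) (hv' : v ∉ LinearMap.range D) (e : V') (he : D' e = i v)
    (hspan : ∀ y, ∃ (c : ℂ) (x : V), y = c • e + i x) [Module.Finite ℂ (endHomology D)] :
    Module.finrank ℂ (endHomology D') < Module.finrank ℂ (endHomology D) := by
  have hsurj : Function.Surjective (endHomologyMap hi) := by
    intro y
    obtain ⟨⟨y, hy⟩, rfl⟩ := Submodule.Quotient.mk_surjective _ y
    obtain ⟨c, x, rfl⟩ := hspan y
    have h1 : D' (c • e + i x) = 0 := hy
    have h2 : c • v + D x = 0 := hinj (by rw [map_add, map_smul, ← he, ← hi, map_zero, ← h1, map_add, map_smul])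
    -- With a nonzero coefficient, `v` would be the boundary of a multiple of `x`. So every cocycle
    -- of the extension comes from the subcomplex.
    have hc : c = 0 := by
      by_contra hc
      refine hv' ⟨-(c⁻¹ • x), ?_⟩
      rw [map_neg, map_smul, eq_neg_of_add_eq_zero_right h2, smul_neg, neg_neg, inv_smul_smul₀ hc]
    subst hc
    rw [zero_smul, zero_add] at h2
    exact ⟨Submodule.Quotient.mk ⟨x, h2⟩, by
      rw [endHomologyMap_mk hi x h2 (by rw [hi, h2, map_zero])]
      congr 2
      rw [zero_smul, zero_add]⟩
  have h0 : endHomologyMap hi (Submodule.Quotient.mk ⟨v, hv⟩) = 0 := by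
    rw [endHomologyMap_mk hi v hv (by rw [hi, hv, map_zero]), Submodule.Quotient.mk_eq_zero]
    exact ⟨e, he⟩
  have h1 : (Submodule.Quotient.mk ⟨v, hv⟩ : endHomology D) ≠ 0 := fun h =>
    hv' ((Submodule.Quotient.mk_eq_zero ((LinearMap.range D).comap (LinearMap.ker D).subtype)).1 h)
  have h2 := LinearMap.finrank_range_add_finrank_ker (endHomologyMap hi)
  rw [LinearMap.range_eq_top.2 hsurj, finrank_top] at h2
  have h3 : 0 < Module.finrank ℂ (LinearMap.ker (endHomologyMap hi)) :=
    Module.finrank_pos_iff_exists_ne_zero.2 ⟨⟨_, h0⟩, fun h => h1 (congrArg Subtype.val h)⟩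
  omega

end LinearAlgebra

/-! ### Insertion sums after adjoining one object -/

namespace Chain

variable {Ob : Type u} {H : Ob → Ob → Type v} {ι : Type} (X₀ : Ob) (C : ι → Ob)

/-- The family of objects `C` together with one more object `X₀`. -/
abbrev adjoinObj : Option ι → Ob := fun o => Option.rec X₀ C o

variable {X₀ C}

/-- A vector of morphisms to the objects `adjoinObj X₀ C`. -/
abbrev adjoinHom {X : Ob} (a : H X X₀) (c : ∀ i, H X (C i)) : ∀ o, H X (adjoinObj X₀ C o) :=
  fun o => Option.rec a c o

variable [∀ X Y, AddCommGroup (H X Y)]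

theorem adjoinHom_zero {X : Ob} : adjoinHom (0 : H X X₀) (0 : ∀ i, H X (C i)) = 0 :=
  funext fun o => by cases o <;> rfl

theorem adjoinHom_add {X : Ob} (a a' : H X X₀) (c c' : ∀ i, H X (C i)) :
    adjoinHom (a + a') (c + c') = adjoinHom a c + adjoinHom a' c' :=
  funext fun o => by cases o <;> rfl

theorem adjoinHom_zero_sum {X : Ob} {κ : Type*} (s : Finset κ) (c : κ → ∀ i, H X (C i)) :
    adjoinHom (0 : H X X₀) (∑ k ∈ s, c k) = ∑ k ∈ s, adjoinHom (0 : H X X₀) (c k) := by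
  classical
  induction s using Finset.induction_on with
  | empty => exact adjoinHom_zero
  | insert k s hk ih =>
    rw [Finset.sum_insert hk, Finset.sum_insert hk, ← ih, ← adjoinHom_add, add_zero]

theorem Multilinear.append_zero [∀ X Y, Module ℂ (H X Y)] {V : Type w} [AddCommGroup V] [Module ℂ V] {X Y Z Z' : Ob}
    {f : Chain H X Y → V} (hf : Multilinear f) (l : Chain H Z' Y) (r : Chain H X Z) :
    f (l.append (cons (0 : H Z Z') r)) = 0 := by
  simpa using hf.2 _ _ l 0 0 r

/-- The matrix obtained from `D` by adding entries `c i` from the new object `X₀`. -/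
abbrev adjoinMatrix (D : ∀ i j, H (C i) (C j)) (c : ∀ i, H X₀ (C i)) :
    ∀ o o', H (adjoinObj X₀ C o) (adjoinObj X₀ C o') :=
  fun o => Option.rec (adjoinHom 0 c) (fun i => adjoinHom 0 (D i)) o

variable [DecidableEq ι]

theorem single_none_eq_adjoinHom {X : Ob} (a : H X X₀) :
    (Pi.single none a : ∀ o, H X (adjoinObj X₀ C o)) = adjoinHom a 0 := by
  funext o
  cases o with
  | none => exact Pi.single_eq_same _ _
  | some i => exact Pi.single_eq_of_ne (by simp) _

theorem single_some_eq_adjoinHom {X : Ob} (i : ι) (a : H X (C i)) :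
    (Pi.single (some i) a : ∀ o, H X (adjoinObj X₀ C o)) =
      adjoinHom 0 (Pi.single i a : ∀ j, H X (C j)) := by
  funext o
  cases o with
  | none => exact Pi.single_eq_of_ne (by simp) _
  | some j =>
    by_cases h : j = i
    · subst h
      exact (Pi.single_eq_same _ _).trans (Pi.single_eq_same (M := fun i => H X (C i)) _ _).symm
    · exact (Pi.single_eq_of_ne (by simpa using h) _).trans
        (Pi.single_eq_of_ne (M := fun i => H X (C i)) h _).symm

variable [Fintype ι] [∀ X Y, Module ℂ (H X Y)] {μ : ∀ X Y : Ob, Chain H X Y → H X Y}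

theorem leftInsert_append_zero (hμ : ∀ X Y, Multilinear (μ X Y)) (D : ∀ i j, H (C i) (C j))
    {X Z Z' : Ob} (n : ℕ) (i : ι) (l : Chain H Z' (C i)) (r : Chain H X Z) :
    leftInsert μ D n i (l.append (cons (0 : H Z Z') r)) = 0 := by
  induction n generalizing i l with
  | zero => rw [leftInsert, (hμ _ _).append_zero, Pi.single_zero]
  | succ n ih =>
    rw [leftInsert, (hμ _ _).append_zero, Pi.single_zero, zero_add]
    exact Finset.sum_eq_zero fun j _ => ih j (cons (D i j) l)

/-- No nonzero entry of the matrix leads to the new index, so a string of insertions that starts at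
an old index never meets it. -/
theorem leftInsert_adjoinMatrix_some (hμ : ∀ X Y, Multilinear (μ X Y))
    (D : ∀ i j, H (C i) (C j)) (c : ∀ i, H X₀ (C i)) {X : Ob} (n : ℕ) (i : ι)
    (q : Chain H X (C i)) :
    leftInsert μ (adjoinMatrix D c) n (some i) q = adjoinHom 0 (leftInsert μ D n i q) := by
  induction n generalizing i with
  | zero => exact single_some_eq_adjoinHom i _
  | succ n ih =>
    rw [leftInsert, leftInsert, Fintype.sum_option]
    have h0 : leftInsert μ (adjoinMatrix D c) n none
        (cons (adjoinMatrix D c (some i) none) q) = 0 :=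
      leftInsert_append_zero hμ _ n none nil q
    rw [h0, zero_add, ← zero_add (0 : H X X₀), adjoinHom_add, adjoinHom_zero_sum]
    exact congrArg₂ (· + ·) (single_some_eq_adjoinHom i _)
      (Finset.sum_congr rfl fun j _ => ih j _)

/-- A string starting at the new index is either empty or leaves at once by some `c j`, and then
uses only old entries. The first move accounts for the shift from `n + 1` to `n`. -/
theorem leftInsert_adjoinMatrix_none (hμ : ∀ X Y, Multilinear (μ X Y))
    (D : ∀ i j, H (C i) (C j)) (c : ∀ i, H X₀ (C i)) {X : Ob} (n : ℕ) (q : Chain H X X₀) :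
    leftInsert μ (adjoinMatrix D c) (n + 1) none q =
      adjoinHom (μ _ _ q) (∑ j, leftInsert μ D n j (cons (c j) q)) := by
  rw [leftInsert, Fintype.sum_option]
  have h0 : leftInsert μ (adjoinMatrix D c) n none
      (cons (adjoinMatrix D c none none) q) = 0 :=
    leftInsert_append_zero hμ _ n none nil q
  rw [h0, zero_add]
  refine (congrArg₂ (· + ·) (single_none_eq_adjoinHom (μ X X₀ q)) (Finset.sum_congr rfl fun j _ =>
    leftInsert_adjoinMatrix_some hμ D c n j _)).trans ?_
  rw [← adjoinHom_zero_sum]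
  refine (adjoinHom_add _ _ _ _).symm.trans ?_
  rw [add_zero, zero_add]

end Chain

/-! ### The mapping cone of a cocycle, as an equivariant twisted complex -/

namespace EqTwistedComplex

open Chain

variable {Ob : Type u} {A : AInfCat.{u, v} Ob} {α : NaiveAction A} (C : EqTwistedComplex α)

/-- The sign put on `c` is its own inverse, so it cancels the Koszul sign of the additive
enlargement, and `c` itself appears in the insertion sums. -/
theorem smul_adjoinMatrix (X₀ : Ob) (n : ℤ) (c : ∀ i, A.Hom X₀ (C.X i)) :
    (fun o o' : Option C.ι => ((Option.rec n C.deg o : ℤ) *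
      ((Option.rec n C.deg o : ℤ) - (Option.rec n C.deg o' : ℤ))).negOnePow •
        adjoinMatrix C.δ (fun i => (n * (n - C.deg i)).negOnePow • c i) o o') =
      adjoinMatrix C.δs c := by
  funext o o'
  cases o <;> cases o'
  · exact smul_zero _
  · exact (smul_smul _ _ _).trans (by rw [Int.units_mul_self, one_smul])
  · exact smul_zero _
  · rfl

/-- The mapping cone of the morphism from `X₀`, placed in degree `n` and weight `k`, to the twisted
complex `C` which is given by a cocycle `c` in the Yoneda image of `C`. -/
def adjoin (X₀ : Ob) (n k : ℤ) (c : ∀ i, A.Hom X₀ (C.X i)) (hn : c ∈ C.yoneda.gr X₀ (n + 1))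
    (hk : c ∈ weightSpace (C.yonedaEquivariant.ρ X₀) k) (hd : C.yoneda.d X₀ c = 0) :
    EqTwistedComplex α :=
  let deg : Option C.ι → ℤ := fun o => Option.rec n C.deg o
  let δ : ∀ o o', A.Hom (adjoinObj X₀ C.X o) (adjoinObj X₀ C.X o') :=
    adjoinMatrix C.δ fun i => (n * (n - C.deg i)).negOnePow • c i
  { ι := Option C.ι
    X := adjoinObj X₀ C.X
    deg := deg
    δ := δ
    δ_degree := by
      intro o o'
      cases o <;> cases o'
      · exact Submodule.zero_mem _
      · rename_i j
        have h : c j ∈ A.gr X₀ (C.X j) (1 + n - C.deg j) := by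
          rw [add_comm 1 n]
          exact hn j (Set.mem_univ j)
        change (n * (n - C.deg j)).negOnePow • c j ∈ A.gr X₀ (C.X j) (1 + n - C.deg j)
        rcases Int.even_or_odd (n * (n - C.deg j)) with h' | h'
        · simpa [Int.negOnePow_even _ h'] using h
        · simpa [Int.negOnePow_odd _ h'] using h
      · exact Submodule.zero_mem _
      · exact C.δ_degree _ _
    -- The new index lies strictly above all old ones. After the first insertion a budget of
    -- `Finset.univ.sup C.fil` remains, which suffices for every old index.
    fil := fun o => Option.rec (Finset.univ.sup C.fil + 1) C.fil o
    δ_fil := by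
      intro o o' h
      cases o <;> cases o'
      · exact absurd rfl h
      · exact Nat.lt_succ_of_le (Finset.le_sup (f := C.fil) (Finset.mem_univ _))
      · exact absurd rfl h
      · exact C.δ_fil _ _ h
    maurer_cartan := by
      intro o
      rw [C.smul_adjoinMatrix]
      cases o with
      | none =>
        refine (leftInsert_adjoinMatrix_none A.μ_multilinear C.δs c _ nil).trans ?_
        -- The component of the Maurer-Cartan equation from the new index to the old ones is exactly
        -- the cocycle condition on `c`.
        have h : ∑ j, leftInsert A.μ C.δs (Finset.univ.sup C.fil) j (cons (c j) nil) = 0 :=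
          (Finset.sum_congr rfl fun j _ => C.leftInsert_stable _ j _
            (Finset.le_sup (Finset.mem_univ j))).trans hd
        rw [h, A.μ_nil]
        exact adjoinHom_zero
      | some i =>
        refine (leftInsert_adjoinMatrix_some A.μ_multilinear C.δs c _ i nil).trans ?_
        refine Eq.trans (congrArg _ ?_) adjoinHom_zero
        exact C.maurer_cartan i
    wt := fun o => Option.rec k C.wt o
    δ_invariant := by
      intro z o o'
      cases o <;> cases o'
      · exact (congrArg _ (map_zero _)).trans (smul_zero _)
      · rename_i j
        have h : ((z ^ C.wt j : ℂˣ) : ℂ) • α.ρ X₀ (C.X j) z (c j) =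
            ((z ^ k : ℂˣ) : ℂ) • c j := congrFun (hk z) j
        have h' : ((z ^ (C.wt j - k) : ℂˣ) : ℂ) • α.ρ X₀ (C.X j) z (c j) = c j := by
          rw [sub_eq_neg_add, zpow_add, Units.val_mul, mul_smul, h, smul_smul, ← Units.val_mul,
            ← zpow_add, neg_add_cancel, zpow_zero, Units.val_one, one_smul]
        change ((z ^ (C.wt j - k) : ℂˣ) : ℂ) • α.ρ X₀ (C.X j) z
          ((n * (n - C.deg j)).negOnePow • c j) = (n * (n - C.deg j)).negOnePow • c j
        rcases Int.even_or_odd (n * (n - C.deg j)) with hp | hp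
        · simpa [Int.negOnePow_even _ hp] using h'
        · simpa [Int.negOnePow_odd _ hp] using h'
      · exact (congrArg _ (map_zero _)).trans (smul_zero _)
      · exact C.δ_invariant z _ _ }

section Adjoin

variable {C} {X₀ : Ob} {n k : ℤ} {c : ∀ i, A.Hom X₀ (C.X i)} (hn : c ∈ C.yoneda.gr X₀ (n + 1))
  (hk : c ∈ weightSpace (C.yonedaEquivariant.ρ X₀) k) (hd : C.yoneda.d X₀ c = 0)

/-- The operations of the Yoneda image of the mapping cone. -/
theorem adjoin_yoneda_μ {X Y : Ob} (p : Chain A.Hom X Y) (a : A.Hom Y X₀)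
    (b : ∀ i, A.Hom Y (C.X i)) :
    (C.adjoin X₀ n k c hn hk hd).yoneda.μ X Y p (adjoinHom a b) =
      (adjoinHom (A.μ _ _ (cons a p)) (C.yoneda.μ X X₀ (cons a p) c + C.yoneda.μ X Y p b) :
        ∀ o, A.Hom X (adjoinObj X₀ C.X o)) := by
  -- Once the signs are absorbed, the insertion sums are those of the adjoined matrix.
  have h0 : ∀ (o : Option C.ι) (q : Chain A.Hom X (adjoinObj X₀ C.X o)),
      (C.adjoin X₀ n k c hn hk hd).ins o q =
        leftInsert A.μ (adjoinMatrix C.δs c) ((C.adjoin X₀ n k c hn hk hd).fil o) o q :=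
    fun o q => congrArg (fun D => leftInsert A.μ D _ o q) (C.smul_adjoinMatrix X₀ n c)
  have h1 : (C.adjoin X₀ n k c hn hk hd).ins none (cons a p) =
      (adjoinHom (A.μ _ _ (cons a p)) (C.yoneda.μ X X₀ (cons a p) c) :
        ∀ o, A.Hom X (adjoinObj X₀ C.X o)) := by
    refine (h0 none _).trans ((leftInsert_adjoinMatrix_none A.μ_multilinear C.δs c _ _).trans ?_)
    refine congrArg _ (Finset.sum_congr rfl fun j _ => ?_)
    exact C.leftInsert_stable _ j _ (Finset.le_sup (Finset.mem_univ j))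
  have h2 : ∀ i, (C.adjoin X₀ n k c hn hk hd).ins (some i) (cons (b i) p) =
      (adjoinHom 0 (C.ins i (cons (b i) p)) : ∀ o, A.Hom X (adjoinObj X₀ C.X o)) := by
    intro i
    exact (h0 (some i) _).trans (leftInsert_adjoinMatrix_some A.μ_multilinear C.δs c _ _ _)
  have h3 : (C.adjoin X₀ n k c hn hk hd).yoneda.μ X Y p (adjoinHom a b) =
      (C.adjoin X₀ n k c hn hk hd).ins none (cons a p) +
        ∑ i, (C.adjoin X₀ n k c hn hk hd).ins (some i) (cons (b i) p) :=
    Fintype.sum_option _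
  rw [h3, h1, Finset.sum_congr rfl fun i _ => h2 i]
  refine Eq.trans (congrArg _ (adjoinHom_zero_sum _ _).symm) ?_
  rw [← add_zero (A.μ _ _ (cons a p))]
  refine Eq.trans (adjoinHom_add _ _ _ _).symm ?_
  rw [add_zero]
  rfl

end Adjoin

end EqTwistedComplex

/-! ### The cone of a module homomorphism -/

theorem Chain.Multilinear.add {Ob : Type u} {H : Ob → Ob → Type v} [∀ X Y, AddCommGroup (H X Y)]
    [∀ X Y, Module ℂ (H X Y)] {V : Type w} [AddCommGroup V] [Module ℂ V] {X Y : Ob}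
    {f g : Chain H X Y → V} (hf : Multilinear f) (hg : Multilinear g) :
    Multilinear fun p => f p + g p := by
  refine ⟨fun Z Z' l a b r => ?_, fun Z Z' l z a r => ?_⟩
  · simp only [hf.1, hg.1]
    abel
  · simp only [hf.2, hg.2, smul_add]

namespace AInfMod.ClosedHom

open Chain

variable {Ob : Type u} {A : AInfCat.{u, v} Ob} {M : AInfMod.{u, v, w} A} {N : AInfMod.{u, v, w'} A}
  (f : ClosedHom M N)

/-- The differential of the mapping cone of `f`. -/
def coneD (X : Ob) : M.obj X × N.obj X →ₗ[ℂ] M.obj X × N.obj X :=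
  ((M.d X) ∘ₗ LinearMap.fst ℂ _ _).prod (f.t X X .nil ∘ₗ LinearMap.fst ℂ _ _ +
    N.d X ∘ₗ LinearMap.snd ℂ _ _)

theorem coneD_apply (X : Ob) (v : M.obj X × N.obj X) :
    f.coneD X v = (M.d X v.1, f.t X X .nil v.1 + N.d X v.2) := rfl

theorem _root_.AInfMod.d_d (X : Ob) (b : M.obj X) : M.d X (M.d X b) = 0 := by
  have h := M.ainf X X b .nil
  have h0 : M.μ X X (.cons (0 : A.Hom X X) .nil) b = 0 := (M.μ_multilinear X X b).cons_zero _
  simpa [Chain.Homog.splitSum, Chain.splits, Chain.insertSum, Chain.Homog.val, Chain.map,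
    Chain.Homog.rdeg, Chain.append, A.μ_nil, h0, AInfMod.d] using h

/-- With the present sign conventions `t^1` anticommutes with `μ^1`, so the cone needs no extra
sign. -/
theorem coneD_coneD (X : Ob) (v : M.obj X × N.obj X) : f.coneD X (f.coneD X v) = 0 := by
  rw [coneD_apply, coneD_apply, map_add, N.d_d, M.d_d, add_zero, add_comm, f.anticomm]
  rfl

/-- The components of the morphism from a Yoneda module to the target of `f` which belong to an
element of the mapping cone of `f`. -/
def coneEval {X₀ : Ob} (v : M.obj X₀ × N.obj X₀) {X : Ob} (q : Chain A.Hom X X₀) : N.obj X :=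
  f.t X X₀ q v.1 + N.μ X X₀ q v.2

theorem coneEval_multilinear {X₀ : Ob} (v : M.obj X₀ × N.obj X₀) (X : Ob) :
    Multilinear (f.coneEval v (X := X)) :=
  (f.multilinear X X₀ v.1).add (N.μ_multilinear X X₀ v.2)

/-- This is the part of the closedness equation of the extended homomorphism that concerns the new
summand. It is the sum of the closedness equation of `f` at `v.1` and the module equation of `N` at
`v.2`, both for the sequence `(a, p)`. -/
theorem coneEval_closed {X₀ : Ob} (v : M.obj X₀ × N.obj X₀) (hv : f.coneD X₀ v = 0) {X Y : Ob}
    (a : A.Hom Y X₀) (p : Homog A.gr X Y) :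
    p.splitSum (fun Z l r => N.μ X Z r (f.coneEval v (cons a l)) +
      (f.t X Z r (M.μ Z X₀ (cons a l) v.1) + f.coneEval v (cons (A.μ Z X₀ (cons a l)) r)) +
        insertSum A.μ (fun q => f.coneEval v (cons a q)) l r) = 0 := by
  obtain ⟨hc, hm⟩ := Prod.ext_iff.1 hv
  have h1 : ∀ (n : ℤ) (a : A.Hom Y X₀), a ∈ A.gr Y X₀ n →
      p.splitSum (fun Z l r => N.μ X Z r (f.coneEval v (cons a l)) +
        (f.t X Z r (M.μ Z X₀ (cons a l) v.1) + f.coneEval v (cons (A.μ Z X₀ (cons a l)) r)) +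
          insertSum A.μ (fun q => f.coneEval v (cons a q)) l r) = 0 := by
    intro n a ha
    have e1 := f.closed X X₀ v.1 (cons ⟨n, a, ha⟩ p)
    have e2 := N.ainf X X₀ v.2 (cons ⟨n, a, ha⟩ p)
    rw [Homog.splitSum_cons, insertSum_nil, A.μ_nil, (f.multilinear X X₀ v.1).cons_zero,
      add_zero] at e1
    rw [Homog.splitSum_cons, insertSum_nil, A.μ_nil, (N.μ_multilinear X X₀ v.2).cons_zero,
      add_zero] at e2
    have e3 := congrArg₂ (· + ·) e1 e2
    simp only [add_zero] at e3
    rw [add_add_add_comm, ← smul_add, ← Homog.splitSum_add] at e3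
    -- The terms in which nothing of the sequence is used in the first operation assemble to
    -- expressions in the two components of `coneD v`, and vanish.
    have e4 : N.μ X X₀ (Homog.val (cons ⟨n, a, ha⟩ p : Homog A.gr X X₀)) (f.t X₀ X₀ nil v.1) +
        f.t X X₀ (Homog.val (cons ⟨n, a, ha⟩ p : Homog A.gr X X₀)) (M.μ X₀ X₀ nil v.1) +
        N.μ X X₀ (Homog.val (cons ⟨n, a, ha⟩ p : Homog A.gr X X₀)) (N.μ X₀ X₀ nil v.2) = 0 := by
      rw [show M.μ X₀ X₀ nil v.1 = 0 from hc, map_zero, add_zero, ← map_add,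
        show f.t X₀ X₀ nil v.1 + N.μ X₀ X₀ nil v.2 = 0 from hm, map_zero]
    rw [e4, smul_zero, zero_add] at e3
    rw [← e3]
    refine Homog.splitSum_congr (fun Z l r => ?_) p
    rw [insertSum_cons, insertSum_cons]
    simp only [coneEval, insertSum_add, map_add]
    abel
  -- The signs do not involve the degree of `a`, so the homogeneous case extends by linearity.
  have ha : a ∈ ⨆ n, A.gr Y X₀ n := by
    rw [((DirectSum.isInternal_submodule_iff_iSupIndep_and_iSup_eq_top _).1
      (A.gr_internal Y X₀)).2]
    exact Submodule.mem_top
  have hz := fun {X : Ob} => (f.coneEval_multilinear v X)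
  induction ha using Submodule.iSup_induction' with
  | mem n a ha => exact h1 n a ha
  | zero =>
    rw [← Homog.splitSum_zero (V := N.obj X) p]
    refine Homog.splitSum_congr (fun Z l r => ?_) p
    simp [hz.cons_zero, (A.μ_multilinear Z X₀).cons_zero, (M.μ_multilinear Z X₀ v.1).cons_zero,
      insertSum]
  | add a b _ _ iha ihb =>
    have h := congrArg₂ (· + ·) iha ihb
    simp only [← Homog.splitSum_add, add_zero] at h
    rw [← h]
    refine Homog.splitSum_congr (fun Z l r => ?_) p
    simp only [hz.cons_add, (A.μ_multilinear Z X₀).cons_add, (M.μ_multilinear Z X₀ v.1).cons_add,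
      map_add, insertSum_add]
    abel

/-- Strict unitality of module homomorphisms. -/
def IsUnital : Prop :=
  ∀ (X Y Z : Ob) (b : M.obj Y) (l : Chain A.Hom Z Y) (r : Chain A.Hom X Z),
    f.t X Y (l.append (cons (A.e Z) r)) b = 0

end AInfMod.ClosedHom

/-! ### Extending a homomorphism over the mapping cone -/

namespace EqTwistedComplex

open Chain AInfMod

variable {Ob : Type u} {A : AInfCat.{u, v} Ob} {α : NaiveAction A} {M : AInfMod.{u, v, w} A}
  {C : EqTwistedComplex α} (f : ClosedHom C.yoneda M) {X₀ : Ob} {n k : ℤ}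
  (v : C.yoneda.obj X₀ × M.obj X₀) (hn : v.1 ∈ C.yoneda.gr X₀ (n + 1)) (hn' : v.2 ∈ M.gr X₀ n)
  (hk : v.1 ∈ weightSpace (C.yonedaEquivariant.ρ X₀) k) (hv : f.coneD X₀ v = 0)

/-- The mapping cone determined by a cocycle in the cone of `f`. -/
abbrev coneAdjoin : EqTwistedComplex α :=
  C.adjoin X₀ n k v.1 hn hk (congrArg Prod.fst hv)

/-- The extension of `f` to the mapping cone determined by a cocycle in the cone of `f`. -/
def adjoinClosedHom : ClosedHom (coneAdjoin f v hn hk hv).yoneda M where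
  t X Y p :=
    { toFun := fun b => f.t X Y p (fun i => b (some i)) + f.coneEval v (cons (b none) p)
      map_add' := fun b b' => by
        have h := (f.coneEval_multilinear v X).cons_add (b none) (b' none) p
        have h' := map_add (f.t X Y p) (fun i => b (some i)) (fun i => b' (some i))
        exact (congrArg₂ (· + ·) h' h).trans (add_add_add_comm _ _ _ _)
      map_smul' := fun z b => by
        have h := (f.coneEval_multilinear v X).cons_smul z (b none) p
        have h' := map_smul (f.t X Y p) z (fun i => b (some i))
        exact (congrArg₂ (· + ·) h' h).trans (smul_add _ _ _).symm }
  multilinear X Y b :=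
    (f.multilinear X Y fun i => b (some i)).add
      ((f.coneEval_multilinear v X).cons_right (b none))
  degree X Y n' b hb p := by
    -- The new summand sits in degree `n`; the degree `n + 1` of `v.1` and the degree 1 shift of
    -- `M.μ` then give both terms the same degree.
    have hb0 : b none ∈ A.gr Y X₀ (n' - n) := hb none (Set.mem_univ _)
    refine Submodule.add_mem _ (f.degree X Y n' _ (fun i _ => hb (some i) (Set.mem_univ _)) p)
      (Submodule.add_mem _ ?_ ?_)
    · have h := f.degree X X₀ (n + 1) v.1 hn (cons ⟨n' - n, b none, hb0⟩ p)
      have e : n + 1 + Homog.rdeg (cons ⟨n' - n, b none, hb0⟩ p : Homog A.gr X X₀) =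
          n' + p.rdeg := by
        rw [Homog.rdeg]
        ring
      rw [e] at h
      exact h
    · have h := M.μ_degree X X₀ n v.2 hn' (cons ⟨n' - n, b none, hb0⟩ p)
      have e : n + Homog.rdeg (cons ⟨n' - n, b none, hb0⟩ p : Homog A.gr X X₀) + 1 =
          n' + p.rdeg := by
        rw [Homog.rdeg]
        ring
      rw [e] at h
      exact h
  closed X Y b p := by
    have h1 := f.coneEval_closed v hv (b none) p
    have h2 := f.closed X Y (fun i => b (some i)) p
    have h := congrArg₂ (· + ·) h2 h1
    simp only [← Homog.splitSum_add, add_zero] at h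
    rw [← h]
    refine Homog.splitSum_congr (fun Z l r => ?_) p
    have hb : b = (adjoinHom (b none) fun i => b (some i) :
        ∀ o, A.Hom Y (adjoinObj X₀ C.X o)) := funext fun o => by cases o <;> rfl
    have hμ := (congrArg ((coneAdjoin f v hn hk hv).yoneda.μ Z Y l) hb).trans
      (adjoin_yoneda_μ hn hk (congrArg Prod.fst hv) l (b none) fun i => b (some i))
    have hμ₁ : (fun i => (coneAdjoin f v hn hk hv).yoneda.μ Z Y l b (some i)) =
        C.yoneda.μ Z X₀ (cons (b none) l) v.1 + C.yoneda.μ Z Y l fun i => b (some i) :=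
      funext fun i => congrFun hμ (some i)
    have hμ₀ : (coneAdjoin f v hn hk hv).yoneda.μ Z Y l b none =
        A.μ Z X₀ (cons (b none) l) := congrFun hμ none
    change M.μ X Z r (f.t Z Y l (fun i => b (some i)) + f.coneEval v (cons (b none) l)) +
      (f.t X Z r (fun i => (coneAdjoin f v hn hk hv).yoneda.μ Z Y l b (some i)) +
        f.coneEval v (cons ((coneAdjoin f v hn hk hv).yoneda.μ Z Y l b none) r)) +
      insertSum A.μ (fun q => f.t X Y q (fun i => b (some i)) +
        f.coneEval v (cons (b none) q)) l r = _
    rw [hμ₁, hμ₀, map_add, map_add, insertSum_add]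
    abel

theorem adjoinClosedHom_t (X Y : Ob) (p : Chain A.Hom X Y) (b) :
    (adjoinClosedHom f v hn hn' hk hv).t X Y p b =
      f.t X Y p (fun i => b (some i)) + f.coneEval v (cons (b none) p) := rfl

theorem adjoinClosedHom_isUnital (hf : f.IsUnital) :
    (adjoinClosedHom f v hn hn' hk hv).IsUnital := by
  intro X Y Z b l r
  have h1 := hf X Y Z (fun i => b (some i)) l r
  have h2 := hf X X₀ Z v.1 (cons (b none) l) r
  -- The entry `b none` always stands to the left of the identity, so the exceptional case `μ^2(m,
  -- e) = m` does not occur.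
  have h3 := M.μ_e_zero X X₀ Z v.2 (cons (b none) l) r (by simp only [Chain.length]; omega)
  rw [adjoinClosedHom_t, h1, zero_add]
  exact (congrArg₂ (· + ·) h2 h3).trans (add_zero 0)

theorem adjoinClosedHom_isInvariant (σ : EquivariantStructure α M)
    (hk' : v.2 ∈ weightSpace (σ.ρ X₀) k) (hf : f.IsInvariant C.yonedaEquivariant σ) :
    (adjoinClosedHom f v hn hn' hk hv).IsInvariant
      (coneAdjoin f v hn hk hv).yonedaEquivariant σ := by
  intro X Y z b p
  have h1 := hf X Y z (fun i => b (some i)) p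
  have h2 := hf X X₀ z v.1 (cons (b none) p)
  have h3 := σ.μ_equivariant X X₀ z v.2 (cons (b none) p)
  -- Both parts of `v` have weight `k`, which is the weight given to the new summand.
  rw [hk z, map_smul] at h2
  rw [hk' z, map_smul] at h3
  rw [adjoinClosedHom_t, adjoinClosedHom_t, map_add]
  refine congrArg₂ (· + ·) h1 ?_
  refine ((f.coneEval_multilinear v X).cons_smul ((z ^ k : ℂˣ) : ℂ) (α.ρ Y X₀ z (b none)) _).trans ?_
  rw [ClosedHom.coneEval, ClosedHom.coneEval, smul_add, map_add]
  exact congrArg₂ (· + ·) h2 h3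

/-- The inclusion of the cone of `f` into the cone of its extension. -/
def coneInclusion (X : Ob) : C.yoneda.obj X × M.obj X →ₗ[ℂ]
    (coneAdjoin f v hn hk hv).yoneda.obj X × M.obj X where
  toFun y := ((adjoinHom 0 y.1 : ∀ o, A.Hom X (adjoinObj X₀ C.X o)), y.2)
  map_add' y y' := Prod.ext (funext fun o => by
    cases o
    · exact (add_zero (0 : A.Hom X X₀)).symm
    · rfl) rfl
  map_smul' z y := Prod.ext (funext fun o => by
    cases o
    · exact (smul_zero (A := A.Hom X X₀) z).symm
    · rfl) rfl

theorem coneInclusion_injective (X : Ob) :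
    Function.Injective (coneInclusion f v hn hk hv X) := by
  intro y y' h
  obtain ⟨h1, h2⟩ := Prod.ext_iff.1 h
  exact Prod.ext (funext fun i => congrFun h1 (some i)) h2

/-- The projection of the cone of the extension of `f` to the new summand. -/
def coneProjection (X : Ob) :
    (coneAdjoin f v hn hk hv).yoneda.obj X × M.obj X →ₗ[ℂ] A.Hom X X₀ where
  toFun y := y.1 none
  map_add' _ _ := rfl
  map_smul' _ _ := rfl

theorem exists_coneInclusion_eq (X : Ob) (y) (hy : coneProjection f v hn hk hv X y = 0) :
    ∃ x, coneInclusion f v hn hk hv X x = y :=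
  ⟨(fun i => y.1 (some i), y.2), Prod.ext (funext fun o => by
    cases o
    · exact hy.symm
    · rfl) rfl⟩

theorem coneD_adjoinHom (X : Ob) (a : A.Hom X X₀) (y : C.yoneda.obj X × M.obj X) :
    (adjoinClosedHom f v hn hn' hk hv).coneD X
      ((adjoinHom a y.1 : ∀ o, A.Hom X (adjoinObj X₀ C.X o)), y.2) =
    ((adjoinHom (A.μ X X₀ (cons a nil)) (C.yoneda.μ X X₀ (cons a nil) v.1 + C.yoneda.d X y.1) :
        ∀ o, A.Hom X (adjoinObj X₀ C.X o)),
      f.t X X nil y.1 + f.coneEval v (cons a nil) + M.d X y.2) :=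
  Prod.ext (adjoin_yoneda_μ hn hk (congrArg Prod.fst hv) nil a y.1) rfl

theorem coneD_coneInclusion (X : Ob) (y : C.yoneda.obj X × M.obj X) :
    (adjoinClosedHom f v hn hn' hk hv).coneD X (coneInclusion f v hn hk hv X y) =
      coneInclusion f v hn hk hv X (f.coneD X y) := by
  refine (coneD_adjoinHom f v hn hn' hk hv X 0 y).trans ?_
  rw [(A.μ_multilinear X X₀).cons_zero, (C.yoneda.μ_multilinear X X₀ v.1).cons_zero, zero_add,
    (f.coneEval_multilinear v X).cons_zero, add_zero]
  rfl

/-- The new generator in the cone of the extension of `f`. -/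
def coneGenerator : (coneAdjoin f v hn hk hv).yoneda.obj X₀ × M.obj X₀ :=
  ((adjoinHom (A.e X₀) 0 : ∀ o, A.Hom X₀ (adjoinObj X₀ C.X o)), 0)

theorem exists_eq_smul_coneGenerator_add (he : Submodule.span ℂ {A.e X₀} = ⊤)
    (y : (coneAdjoin f v hn hk hv).yoneda.obj X₀ × M.obj X₀) :
    ∃ (z : ℂ) (x : C.yoneda.obj X₀ × M.obj X₀),
      y = z • coneGenerator f v hn hk hv + coneInclusion f v hn hk hv X₀ x := by
  have h1 : coneProjection f v hn hk hv X₀ y ∈ Submodule.span ℂ {A.e X₀} := by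
    rw [he]
    exact Submodule.mem_top
  obtain ⟨z, hz⟩ := Submodule.mem_span_singleton.1 h1
  obtain ⟨x, hx⟩ := exists_coneInclusion_eq f v hn hk hv X₀ (y - z • coneGenerator f v hn hk hv)
    (by
      rw [map_sub, map_smul]
      exact sub_eq_zero.2 hz.symm)
  exact ⟨z, x, by rw [hx, add_sub_cancel]⟩

/-- The new generator kills the class of `v`. -/
theorem coneD_coneGenerator (hf : f.IsUnital) :
    (adjoinClosedHom f v hn hn' hk hv).coneD X₀ (coneGenerator f v hn hk hv) =
      coneInclusion f v hn hk hv X₀ v := by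
  refine (coneD_adjoinHom f v hn hn' hk hv X₀ (A.e X₀) 0).trans ?_
  -- Strict unitality: `μ^1(e) = 0`, `t^2(c, e) = 0`, and the action of `e` fixes both `c` and `m`.
  -- What remains is exactly `v`.
  have h1 : A.μ X₀ X₀ (cons (A.e X₀) nil) = 0 := A.μ_e_zero X₀ X₀ X₀ nil nil (by simp [Chain.length])
  have h2 := hf X₀ X₀ X₀ v.1 nil nil
  have h3 := M.μ_e X₀ v.2
  have h4 := C.yoneda.μ_e X₀ v.1
  rw [h1, h4, ClosedHom.coneEval, h3]
  change f.t X₀ X₀ (cons (A.e X₀) nil) v.1 = 0 at h2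
  rw [h2]
  simp only [Prod.fst_zero, Prod.snd_zero, map_zero, add_zero, zero_add]
  rfl

end EqTwistedComplex

/-! ### Acyclic cones and homogeneous cocycles -/

namespace AInfMod.ClosedHom

open Chain

variable {Ob : Type u} {A : AInfCat.{u, v} Ob} {M : AInfMod.{u, v, w} A} {N : AInfMod.{u, v, w'} A}
  (f : ClosedHom M N)

theorem isQuasiIso_of_cone_acyclic
    (h : ∀ X, LinearMap.ker (f.coneD X) ≤ LinearMap.range (f.coneD X)) : f.IsQuasiIso := by
  intro X
  constructor
  · rw [← LinearMap.ker_eq_bot, LinearMap.ker_eq_bot']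
    intro y hy
    obtain ⟨⟨c, hc⟩, rfl⟩ := Submodule.Quotient.mk_surjective _ y
    obtain ⟨m, hm⟩ := (Submodule.Quotient.mk_eq_zero _).1 hy
    have hm' : N.d X m = f.t X X nil c := hm
    -- If `t^1(c)` is the boundary of `m`, this pair is a cocycle of the cone; the first part of a
    -- primitive bounds `c`.
    have h0 : ((c, -m) : M.obj X × N.obj X) ∈ LinearMap.ker (f.coneD X) := by
      rw [LinearMap.mem_ker, coneD_apply]
      refine Prod.ext hc ?_
      simp [hm']
    obtain ⟨y, hy⟩ := h X h0
    exact (Submodule.Quotient.mk_eq_zero _).2 ⟨y.1, congrArg Prod.fst hy⟩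
  · intro y
    obtain ⟨⟨m, hm⟩, rfl⟩ := Submodule.Quotient.mk_surjective _ y
    have h0 : ((0, m) : M.obj X × N.obj X) ∈ LinearMap.ker (f.coneD X) := by
      rw [LinearMap.mem_ker, coneD_apply]
      refine Prod.ext (map_zero _) ?_
      simpa using hm
    obtain ⟨y, hy⟩ := h X h0
    obtain ⟨h1, h2⟩ := Prod.ext_iff.1 hy
    refine ⟨Submodule.Quotient.mk ⟨y.1, h1⟩, ?_⟩
    refine (Submodule.Quotient.eq _).2 ⟨-y.2, ?_⟩
    change N.d X (-y.2) = f.t X X nil y.1 - m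
    rw [map_neg, ← (show f.t X X nil y.1 + N.d X y.2 = m from h2)]
    abel

/-- The kernel of the cone differential is spanned by its elements of pure degree and weight, so if
all of those were boundaries, the cone would be acyclic. -/
theorem exists_homogeneous_cocycle {α : NaiveAction A} (σ : EquivariantStructure α M)
    (τ : EquivariantStructure α N) (hf : f.IsInvariant σ τ) (X : Ob)
    (h : ¬ LinearMap.ker (f.coneD X) ≤ LinearMap.range (f.coneD X)) :
    ∃ (n k : ℤ) (v : M.obj X × N.obj X), v.1 ∈ M.gr X (n + 1) ∧ v.2 ∈ N.gr X n ∧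
      v.1 ∈ weightSpace (σ.ρ X) k ∧ v.2 ∈ weightSpace (τ.ρ X) k ∧ f.coneD X v = 0 ∧
        v ∉ LinearMap.range (f.coneD X) := by
  have hM := (DirectSum.isInternal_submodule_iff_iSupIndep_and_iSup_eq_top _).1 (M.gr_internal X)
  have hN := (DirectSum.isInternal_submodule_iff_iSupIndep_and_iSup_eq_top _).1 (N.gr_internal X)
  -- The degree on the cone: the source is shifted by one, so that the differential has degree one.
  let G : ℤ → Submodule ℂ (M.obj X × N.obj X) := fun n => (M.gr X (n + 1)).prod (N.gr X n)
  let W : ℤ → Submodule ℂ (M.obj X × N.obj X) := fun k =>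
    (weightSpace (σ.ρ X) k).prod (weightSpace (τ.ρ X) k)
  have hG : iSupIndep G := iSupIndep_prod (hM.1.comp (add_left_injective 1)) hN.1
  have hW : iSupIndep W := iSupIndep_prod (iSupIndep_weightSpace _) (iSupIndep_weightSpace _)
  have hGtop : ⨆ n, G n = ⊤ := by
    have h1 : ⨆ n, M.gr X n ≤ (⨆ n, G n).comap (LinearMap.inl ℂ _ _) :=
      iSup_le fun n y hy => Submodule.mem_iSup_of_mem (n - 1)
        ⟨by simpa using hy, Submodule.zero_mem _⟩
    have h2 : ⨆ n, N.gr X n ≤ (⨆ n, G n).comap (LinearMap.inr ℂ _ _) :=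
      iSup_le fun n y hy => Submodule.mem_iSup_of_mem n ⟨Submodule.zero_mem _, hy⟩
    rw [hM.2] at h1
    rw [hN.2] at h2
    rw [eq_top_iff]
    rintro ⟨c, m⟩ _
    rw [← add_zero c, ← zero_add m, ← Prod.mk_add_mk]
    exact Submodule.add_mem _ (h1 (Submodule.mem_top (x := c))) (h2 (Submodule.mem_top (x := m)))
  have hGW : ∀ n, G n ≤ ⨆ k, G n ⊓ W k := by
    rintro n ⟨c, m⟩ ⟨hc, hm⟩
    have h1 : ⨆ k, M.gr X (n + 1) ⊓ weightSpace (σ.ρ X) k ≤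
        (⨆ k, G n ⊓ W k).comap (LinearMap.inl ℂ _ _) :=
      iSup_le fun k y hy => Submodule.mem_iSup_of_mem k
        ⟨⟨hy.1, Submodule.zero_mem _⟩, ⟨hy.2, Submodule.zero_mem _⟩⟩
    have h2 : ⨆ k, N.gr X n ⊓ weightSpace (τ.ρ X) k ≤
        (⨆ k, G n ⊓ W k).comap (LinearMap.inr ℂ _ _) :=
      iSup_le fun k y hy => Submodule.mem_iSup_of_mem k
        ⟨⟨Submodule.zero_mem _, hy.1⟩, ⟨Submodule.zero_mem _, hy.2⟩⟩
    rw [← add_zero c, ← zero_add m, ← Prod.mk_add_mk]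
    exact Submodule.add_mem _ (h1 ((σ.graded_rational X).rational _ hc))
      (h2 ((τ.graded_rational X).rational _ hm))
  have hDG : ∀ n, ∀ x ∈ G n, f.coneD X x ∈ G (n + 1) := by
    rintro n ⟨c, m⟩ ⟨hc, hm⟩
    have h1 := M.μ_degree X X (n + 1) c hc nil
    have h2 := f.degree X X (n + 1) c hc nil
    have h3 := N.μ_degree X X n m hm nil
    simp only [Homog.rdeg, add_zero] at h1 h2 h3
    exact ⟨h1, Submodule.add_mem _ h2 h3⟩
  have hDW : ∀ k, ∀ x ∈ W k, f.coneD X x ∈ W k := by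
    rintro k ⟨c, m⟩ ⟨hc, hm⟩
    refine ⟨fun z => ?_, fun z => ?_⟩
    · have h1 := σ.μ_equivariant X X z c nil
      rw [hc z, map_smul] at h1
      exact h1.symm
    · have h2 := hf X X z c nil
      have h3 := τ.μ_equivariant X X z m nil
      rw [hc z, map_smul] at h2
      rw [hm z, map_smul] at h3
      change τ.ρ X z (f.t X X nil c + N.μ X X nil m) = _ • (f.t X X nil c + N.μ X X nil m)
      rw [map_add, smul_add]
      exact congrArg₂ (· + ·) h2.symm h3.symm
  by_contra! hcon
  refine h fun y hy => ?_
  have h1 := ker_inf_iSup_le (f.coneD X) G (fun n => G (n + 1))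
    (hG.comp (add_left_injective 1)) hDG ⟨hy, by rw [hGtop]; exact Submodule.mem_top⟩
  refine (iSup_le fun n y hy => ?_ : ⨆ n, G n ⊓ LinearMap.ker (f.coneD X) ≤ _) h1
  -- Within a fixed degree the cocycle is split further by weight, which the differential preserves.
  have h2 := ker_inf_iSup_le (f.coneD X) (fun k => G n ⊓ W k) W hW
    (fun k x hx => hDW k x hx.2) ⟨hy.2, hGW n hy.1⟩
  refine (iSup_le fun k y hy => ?_ :
    ⨆ k, (G n ⊓ W k) ⊓ LinearMap.ker (f.coneD X) ≤ _) h2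
  exact hcon n k y hy.1.1.1 hy.1.1.2 hy.1.2.1 hy.1.2.2 hy.2

end AInfMod.ClosedHom

/-! ### The inductive construction over the ordered objects -/

namespace EqTwistedComplex

open Chain AInfMod

variable {Ob : Type u} {A : AInfCat.{u, v} Ob} (α : NaiveAction A)

/-- The zero object. -/
def zero : EqTwistedComplex α where
  ι := Empty
  X := Empty.elim
  deg := Empty.elim
  δ i := i.elim
  δ_degree i := i.elim
  fil := Empty.elim
  δ_fil i := i.elim
  maurer_cartan i := i.elim
  wt := Empty.elim
  δ_invariant _ i := i.elim

end EqTwistedComplex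

namespace AInfMod

open Chain

variable {Ob : Type u} {A : AInfCat.{u, v} Ob} {α : NaiveAction A}

/-- The zero homomorphism. -/
def ClosedHom.zero (M : AInfMod.{u, v, w} A) (N : AInfMod.{u, v, w'} A) : ClosedHom M N where
  t _ _ _ := 0
  multilinear _ _ _ := ⟨fun _ _ _ _ _ _ => (add_zero _).symm, fun _ _ _ _ _ _ => (smul_zero _).symm⟩
  degree _ _ _ _ _ _ := Submodule.zero_mem _
  closed X Y b p := by simp [insertSum, Homog.splitSum]

variable {M : AInfMod.{u, v, w} A} (σ : EquivariantStructure α M)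

/-- Unital invariant homomorphisms from the Yoneda image of an equivariant twisted complex to `M`,
whose cone has finite-dimensional cohomology. -/
structure Approximation where
  C : EqTwistedComplex α
  f : ClosedHom C.yoneda M
  isInvariant : f.IsInvariant C.yonedaEquivariant σ
  isUnital : f.IsUnital
  finite : ∀ X, Module.Finite ℂ (endHomology (f.coneD X))

namespace Approximation

variable {σ}

/-- The start of the construction, and the point where finiteness of the cohomology of `M` enters:
the cone of the zero homomorphism from the zero complex is `M` itself. -/
theorem nonempty_of_finite (hM : ∀ X, Module.Finite ℂ (M.cohomology X)) :
    Nonempty (Approximation σ) := by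
  refine ⟨⟨EqTwistedComplex.zero α, ClosedHom.zero _ M, fun X Y z b p => (map_zero _).symm,
    fun _ _ _ _ _ _ => rfl, fun X => ?_⟩⟩
  have : Module.Finite ℂ (endHomology (M.d X)) := hM X
  have hfin : Module.Finite ℂ ((EqTwistedComplex.zero α).yoneda.obj X) := by
    have : ∀ i : (EqTwistedComplex.zero α).ι,
      Module.Finite ℂ (A.Hom X ((EqTwistedComplex.zero α).X i)) := fun i => Empty.elim i
    exact Module.Finite.pi
  refine endHomology_finite_of_extension (D := M.d X) (i := LinearMap.inr ℂ _ _)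
    (fun x => ?_) LinearMap.inr_injective (ClosedHom.coneD_coneD _ X) (LinearMap.fst ℂ _ _) ?_
  · exact Prod.ext (map_zero ((EqTwistedComplex.zero α).yoneda.d X)) (zero_add _)
  · rintro ⟨c, m⟩ hc
    exact ⟨m, Prod.ext hc.symm rfl⟩

/-- `R` is a resolution of `M` at the object `X`. -/
def IsAcyclicAt (R : Approximation σ) (X : Ob) : Prop :=
  LinearMap.ker (R.f.coneD X) ≤ LinearMap.range (R.f.coneD X)

variable [LinearOrder Ob] (hA : A.IsDirected)
include hA

theorem _root_.AInfCat.IsDirected.finite_hom (X Y : Ob) : Module.Finite ℂ (A.Hom X Y) := by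
  rcases lt_trichotomy X Y with h | rfl | h
  · exact hA.finite X Y h
  · exact ⟨by rw [← hA.span_e X]; exact Submodule.fg_span_singleton _⟩
  · have := hA.zero X Y h
    infer_instance

/-- One more generator can be used to decrease the cohomology of the cone at a given object. -/
theorem exists_finrank_lt (R : Approximation σ) (X₀ : Ob) (h : ¬ R.IsAcyclicAt X₀) :
    ∃ R' : Approximation σ,
      Module.finrank ℂ (endHomology (R'.f.coneD X₀)) <
        Module.finrank ℂ (endHomology (R.f.coneD X₀)) ∧
      ∀ X, X₀ < X → R.IsAcyclicAt X → R'.IsAcyclicAt X := by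
  obtain ⟨n, k, v, hn, hn', hk, hk', hv, hv'⟩ :=
    R.f.exists_homogeneous_cocycle R.C.yonedaEquivariant σ R.isInvariant X₀ h
  have hi := EqTwistedComplex.coneD_coneInclusion R.f v hn hn' hk hv
  have hinj := EqTwistedComplex.coneInclusion_injective R.f v hn hk hv
  have hπ := EqTwistedComplex.exists_coneInclusion_eq R.f v hn hk hv
  have hfin := hA.finite_hom
  have hR := R.finite
  refine ⟨⟨EqTwistedComplex.coneAdjoin R.f v hn hk hv,
    EqTwistedComplex.adjoinClosedHom R.f v hn hn' hk hv,
    EqTwistedComplex.adjoinClosedHom_isInvariant R.f v hn hn' hk hv σ hk' R.isInvariant,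
    EqTwistedComplex.adjoinClosedHom_isUnital R.f v hn hn' hk hv R.isUnital,
    fun X => endHomology_finite_of_extension (hi X) (hinj X) (ClosedHom.coneD_coneD _ X)
      (EqTwistedComplex.coneProjection R.f v hn hk hv X) (hπ X)⟩, ?_, ?_⟩
  · exact endHomology_finrank_lt (hi X₀) (hinj X₀) v hv hv' _
      (EqTwistedComplex.coneD_coneGenerator R.f v hn hn' hk hv R.isUnital)
      (EqTwistedComplex.exists_eq_smul_coneGenerator_add R.f v hn hk hv (hA.span_e X₀))
  · intro X hX hac y hy
    -- There are no morphisms from `X` to the smaller object `X₀`, so every element of the new cone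
    -- at `X` comes from the old one.
    have := hA.zero X X₀ hX
    obtain ⟨x, rfl⟩ := hπ X y (Subsingleton.elim _ _)
    have hx : R.f.coneD X x = 0 := hinj X (by rw [← hi, map_zero]; exact hy)
    obtain ⟨x', rfl⟩ := hac hx
    exact ⟨_, hi X x'⟩

/-- The dimension of the cohomology of the cone at `X₀` drops with each new copy of `X₀`, so the
process stops, and it stops only at an acyclic cone. -/
theorem exists_acyclic_insert (R : Approximation σ) (X₀ : Ob) :
    ∃ R' : Approximation σ, R'.IsAcyclicAt X₀ ∧
      ∀ X, X₀ < X → R.IsAcyclicAt X → R'.IsAcyclicAt X := by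
  induction hd : Module.finrank ℂ (endHomology (R.f.coneD X₀)) using Nat.strong_induction_on
    generalizing R with
  | _ d ih =>
  by_cases h : R.IsAcyclicAt X₀
  · exact ⟨R, h, fun _ _ hX => hX⟩
  · obtain ⟨R₁, h₁, h₁'⟩ := R.exists_finrank_lt hA X₀ h
    obtain ⟨R₂, h₂, h₂'⟩ := ih _ (hd ▸ h₁) R₁ rfl
    exact ⟨R₂, h₂, fun X hX hac => h₂' X hX (h₁' X hX hac)⟩

theorem exists_acyclic (hM : ∀ X, Module.Finite ℂ (M.cohomology X)) (s : Finset Ob) :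
    ∃ R : Approximation σ, ∀ X ∈ s, R.IsAcyclicAt X := by
  -- Each new object is smaller than all those already treated. This order is forced: adjoining `X₀`
  -- leaves the cones at larger objects alone but can disturb those at smaller ones.
  induction s using Finset.induction_on_min with
  | empty =>
    obtain ⟨R⟩ := nonempty_of_finite (σ := σ) hM
    exact ⟨R, by simp⟩
  | insert X₀ s hs ih =>
    obtain ⟨R, hR⟩ := ih
    obtain ⟨R', h, h'⟩ := R.exists_acyclic_insert hA X₀
    refine ⟨R', fun X hX => ?_⟩
    rcases Finset.mem_insert.1 hX with rfl | hX
    · exact h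
    · exact h' X (hs X hX) (hR X hX)

end Approximation

end AInfMod

theorem proposition3p2 {Ob : Type u} [Finite Ob] [LinearOrder Ob]
    (A : AInfCat.{u, v} Ob) (hA : A.IsDirected) (α : NaiveAction A)
    (M : AInfMod.{u, v, w} A) (σ : EquivariantStructure α M)
    (hM : ∀ X, Module.Finite ℂ (M.cohomology X)) :
    ∃ (C : EqTwistedComplex α) (f : AInfMod.ClosedHom C.yoneda M),
      f.IsQuasiIso ∧ f.IsInvariant C.yonedaEquivariant σ := by
  have := Fintype.ofFinite Ob
  obtain ⟨R, hR⟩ := AInfMod.Approximation.exists_acyclic (σ := σ) hA hM Finset.univ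
  exact ⟨R.C, R.f, R.f.isQuasiIso_of_cone_acyclic fun X => hR X (Finset.mem_univ X),
    R.isInvariant⟩
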